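/- A scaled simplicial set is a simplicial set together with a set of $2$-simplices, called thin, that contains all degenerate ones; maps of scaled simplicial sets preserve thin $2$-simplices, and $X_\sharp$ denotes $X$ with all $2$-simplices thin. An $\infty$-bicategory $\mathbb{C}$ is a scaled simplicial set with the extension property with respect to all scaled anodyne maps (equivalently, a fibrant object of the bicategorical model structure on scaled simplicial sets). Its underlying $\infty$-category $\mathcal{C}$ is the simplicial subset of $\mathbb{C}$ consisting of the simplices all of whose $2$-dimensional faces are thin. For $n\ge 0$ identify $\Delta^n\star(\Delta^n)^{\mathrm{op}}$ with $\Delta^{2n+1}$, the vertex $i$ of $(\Delta^n)^{\mathrm{op}}$ being $\bar\imath:=2n+1-i$, and let $Q(n)$ be the scaled simplicial set on $\Delta^n\star(\Delta^n)^{\mathrm{op}}$ whose non-degenerate thin $2$-simplices are those contained in $\Delta^n$ or in $(\Delta^n)^{\mathrm{op}}$, together with $\Delta^{\{i,j,\bar k\}}$ and $\Delta^{\{k,\bar\jmath,\bar\imath\}}$ for $0\le i<j\le k\le n$. The $Q(n)$ form a cosimplicial scaled simplicial set. Let $\mathrm{Tw}(\mathbb{C})$ be the marked simplicial set whose $n$-simplices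 are the maps $Q(n)\to\mathbb{C}$, and whose marked edges are the maps $Q(1)\to\mathbb{C}$ that factor through $Q(1)\to\Delta^3_\sharp$. The inclusions $\Delta^n_\sharp\subseteq Q(n)$ and $(\Delta^n)^{\mathrm{op}}_\sharp\subseteq Q(n)$ induce a canonical map of simplicial sets $\mathrm{Tw}(\mathbb{C})\to\mathcal{C}\times\mathcal{C}^{\mathrm{op}}$. Theorem. For every $\infty$-bicategory $\mathbb{C}$ with underlying $\infty$-category $\mathcal{C}$, the canonical map $$\mathrm{Tw}(\mathbb{C})\longrightarrow\mathcal{C}\times\mathcal{C}^{\mathrm{op}}$$ is a Cartesian fibration, and every marked edge of $\mathrm{Tw}(\mathbb{C})$ is Cartesian with respect to it. -/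

import Mathlib

open CategoryTheory Simplicial Opposite MonoidalCategory

universe u

/-! ### Scaled simplicial sets -/

/-- A scaled simplicial set: a simplicial set with a set of `2`-simplices, called thin, which
contains all the degenerate ones. -/
structure ScaledSSet where
  /-- the underlying simplicial set -/
  toSSet : SSet.{u}
  /-- the thin `2`-simplices -/
  thin : Set (toSSet _⦋2⦌)
  degenerate_subset_thin : toSSet.degenerate 2 ⊆ thin

namespace ScaledSSet

/-- A map of scaled simplicial sets: a map of simplicial sets which sends thin `2`-simplices to
thin `2`-simplices. -/
@[ext]
structure Hom (X Y : ScaledSSet.{u}) where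
  /-- the underlying map of simplicial sets -/
  toSSetHom : X.toSSet ⟶ Y.toSSet
  map_thin : ∀ x ∈ X.thin, toSSetHom.app (op ⦋2⦌) x ∈ Y.thin

instance : Category ScaledSSet.{u} where
  Hom := Hom
  id X := ⟨𝟙 X.toSSet, fun _ hx ↦ hx⟩
  comp f g := ⟨f.toSSetHom ≫ g.toSSetHom, fun x hx ↦ g.map_thin _ (f.map_thin x hx)⟩

@[ext]
lemma hom_ext {X Y : ScaledSSet.{u}} {f g : X ⟶ Y}
    (h : Hom.toSSetHom f = Hom.toSSetHom g) : f = g :=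
  Hom.ext h

/-- The scaled simplicial set on `X` whose nondegenerate thin `2`-simplices are those in `T`. -/
def generated (X : SSet.{u}) (T : Set (X _⦋2⦌)) : ScaledSSet.{u} where
  toSSet := X
  thin := X.degenerate 2 ∪ T
  degenerate_subset_thin := Set.subset_union_left

/-- `X` with the maximal scaling (written `X_♯`). -/
def sharp (X : SSet.{u}) : ScaledSSet.{u} where
  toSSet := X
  thin := Set.univ
  degenerate_subset_thin := Set.subset_univ _

/-- The map from a scaled simplicial set to its maximally scaled version, the identity on the
underlying simplicial sets. -/
def toSharp (X : ScaledSSet.{u}) : X ⟶ sharp X.toSSet :=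
  Hom.mk (𝟙 X.toSSet) fun _ _ ↦ Set.mem_univ _

/-- A simplicial subset of a scaled simplicial set, with the induced scaling. -/
def restrict (X : ScaledSSet.{u}) (A : X.toSSet.Subcomplex) : ScaledSSet.{u} where
  toSSet := A
  thin := {x | x.1 ∈ X.thin}
  degenerate_subset_thin := fun _ hx ↦
    X.degenerate_subset_thin (SSet.degenerate_app_apply hx A.ι)

/-- The inclusion of a simplicial subset with the induced scaling. -/
def restrictι (X : ScaledSSet.{u}) (A : X.toSSet.Subcomplex) : X.restrict A ⟶ X :=
  Hom.mk A.ι fun _ hx ↦ hx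

/-- The identity of a simplicial set, as a map from a smaller to a larger scaling. -/
def generatedMono (X : SSet.{u}) {T T' : Set (X _⦋2⦌)} (h : T ⊆ T') :
    generated X T ⟶ generated X T' :=
  Hom.mk (𝟙 X) fun _ hx ↦ Set.union_subset_union_right _ h hx

/-! ### Scaled anodyne maps and `∞`-bicategories -/

/-- `tri n a b c` consists of the `2`-simplex `Δ^{a,b,c}` of `Δ[n]`, whose vertices are `a`, `b`
and `c` (it is empty unless `a ≤ b ≤ c ≤ n`). -/
def tri (n a b c : ℕ) : Set ((Δ[n] : SSet.{u}) _⦋2⦌) :=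
  {s | (s 0 : ℕ) = a ∧ (s 1 : ℕ) = b ∧ (s 2 : ℕ) = c}

/-- The inclusion `Δ^{0,1} ⊆ Δ^n`, for `n = m + 3`. -/
def edgeZeroOne (m : ℕ) : (Δ[1] : SSet.{u}) ⟶ Δ[m + 3] :=
  SSet.yonedaEquiv.symm (SSet.stdSimplex.edge (m + 3) 0 1 (Fin.zero_le _))

/-- The simplicial set `Δ^n ⊔_{Δ^{0,1}} Δ^0`, for `n = m + 3`. -/
noncomputable def collapsed (m : ℕ) : SSet.{u} :=
  Limits.pushout (edgeZeroOne.{u} m) (SSet.stdSimplex.σ (0 : Fin 1))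

/-- The quotient map `Δ^n ⟶ Δ^n ⊔_{Δ^{0,1}} Δ^0`, for `n = m + 3`. -/
noncomputable def toCollapsed (m : ℕ) : (Δ[m + 3] : SSet.{u}) ⟶ collapsed m :=
  Limits.pushout.inl _ _

/-- The generating scaled anodyne maps. -/
inductive GeneratingScaledAnodyne : MorphismProperty ScaledSSet.{u}
  /-- The inclusion of the inner horn `Λ^n_i` into `Δ^n`, where `0 < i < n`, the only
  nondegenerate thin `2`-simplex of `Δ^n` is `Δ^{i-1,i,i+1}`, and `Λ^n_i` carries the
  induced scaling. -/
  | innerHorn (n : ℕ) (i : Fin (n + 1)) (h0 : 0 < i) (hn : i < Fin.last n) :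
    GeneratingScaledAnodyne
      ((generated Δ[n] (tri n ((i : ℕ) - 1) (i : ℕ) ((i : ℕ) + 1))).restrictι Λ[n, i])
  /-- The map `(Δ^4, T) ⟶ (Δ^4, T ∪ {Δ^{0,3,4}, Δ^{0,1,4}})`, where `T` consists of
  `Δ^{0,2,4}`, `Δ^{1,2,3}`, `Δ^{0,1,3}`, `Δ^{1,3,4}`, `Δ^{0,1,2}` and the degenerate
  `2`-simplices. -/
  | saturation :
    GeneratingScaledAnodyne
      (generatedMono Δ[4]
        (T := tri 4 0 2 4 ∪ tri 4 1 2 3 ∪ tri 4 0 1 3 ∪ tri 4 1 3 4 ∪ tri 4 0 1 2)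
        (T' := (tri 4 0 2 4 ∪ tri 4 1 2 3 ∪ tri 4 0 1 3 ∪ tri 4 1 3 4 ∪ tri 4 0 1 2) ∪
          (tri 4 0 3 4 ∪ tri 4 0 1 4))
        Set.subset_union_left)
  /-- For `n = m + 3`, the inclusion
  `Λ^n_0 ⊔_{Δ^{0,1}} Δ^0 ⟶ Δ^n ⊔_{Δ^{0,1}} Δ^0`, where the only nondegenerate thin
  `2`-simplex of the target is the image of `Δ^{0,1,n}` and the source carries the induced
  scaling. As `Δ^{0,1} ⊆ Λ^n_0`, the source is the image of `Λ^n_0` in the target. -/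
  | outerHorn (m : ℕ) :
    GeneratingScaledAnodyne
      ((generated (collapsed m)
          ((toCollapsed m).app (op ⦋2⦌) '' tri (m + 3) 0 1 (m + 3))).restrictι
        (SSet.Subcomplex.range ((Λ[m + 3, 0] : (Δ[m + 3] : SSet.{u}).Subcomplex).ι ≫
          toCollapsed m)))

/-- An `∞`-bicategory: a scaled simplicial set with the extension property with respect to the
(generating) scaled anodyne maps. -/
class IsInftyBicategory (C : ScaledSSet.{u}) : Prop where
  exists_extension : ∀ ⦃A B : ScaledSSet.{u}⦄ (i : A ⟶ B), GeneratingScaledAnodyne i →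
    ∀ f : A ⟶ C, ∃ g : B ⟶ C, i ≫ g = f

/-- The underlying `∞`-category of an `∞`-bicategory: the simplicial subset of those simplices
all of whose `2`-dimensional faces are thin. -/
def underlying (C : ScaledSSet.{u}) : C.toSSet.Subcomplex where
  obj k := {x | ∀ f : ⦋2⦌ ⟶ k.unop, C.toSSet.map f.op x ∈ C.thin}
  map {k l} g x hx := fun f ↦ by
    have h := hx (f ≫ g.unop)
    rw [op_comp, Functor.map_comp_apply] at h
    exact h

end ScaledSSet

/-! ### The cosimplicial scaled simplicial set `Q` -/

/-- The map `[2m+1] ⟶ [2n+1]` induced by `f : [m] ⟶ [n]`, under the identification of `Δ^n ⋆ (Δ^n)ᵒᵖ`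
with `Δ^{2n+1}` in which the vertex `i̅` of `(Δ^n)ᵒᵖ` is `2n+1-i` (that is, `Fin.rev i`): it
sends `i` to `f i` and `i̅` to the vertex corresponding to `f i` in `(Δ^n)ᵒᵖ`. -/
def joinOpMap {m n : ℕ} (f : Fin (m + 1) →o Fin (n + 1)) :
    Fin (2 * m + 1 + 1) →o Fin (2 * n + 1 + 1) where
  toFun j := if h : (j : ℕ) < m + 1 then Fin.castLE (by omega) (f ⟨j, h⟩)
    else (Fin.castLE (by omega) (f ⟨j.rev, by rw [Fin.val_rev]; omega⟩) :
      Fin (2 * n + 1 + 1)).rev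
  monotone' a b hab := by
    have hab' : (a : ℕ) ≤ b := hab
    dsimp only
    split_ifs with ha hb hb
    · exact f.monotone hab
    · rw [Fin.le_def, Fin.val_rev, Fin.val_castLE, Fin.val_castLE]
      omega
    · omega
    · rw [Fin.rev_le_rev]
      exact f.monotone (Fin.rev_le_rev.2 hab)

/-- The vertex `i` of `Δ^n ⊆ Δ^{2n+1}`. -/
def joinVertex {n : ℕ} (i : Fin (n + 1)) : Fin (2 * n + 1 + 1) := Fin.castLE (by omega) i

lemma joinVertex_mono {n : ℕ} {i j : Fin (n + 1)} (h : i ≤ j) : joinVertex i ≤ joinVertex j := h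

lemma lt_joinVertex_rev {n : ℕ} (i : Fin (n + 1)) : n < ((joinVertex i).rev : ℕ) := by
  rw [Fin.val_rev, joinVertex, Fin.val_castLE]
  omega

lemma joinVertex_cases {n : ℕ} (j : Fin (2 * n + 1 + 1)) :
    ∃ i : Fin (n + 1), j = joinVertex i ∨ j = (joinVertex i).rev := by
  by_cases h : (j : ℕ) < n + 1
  · exact ⟨⟨j, h⟩, Or.inl rfl⟩
  · refine ⟨⟨j.rev, by rw [Fin.val_rev]; omega⟩, Or.inr ?_⟩
    exact (Fin.rev_rev j).symm

lemma joinOpMap_vertex {m n : ℕ} (f : Fin (m + 1) →o Fin (n + 1)) (i : Fin (m + 1)) :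
    joinOpMap f (joinVertex i) = joinVertex (f i) :=
  dif_pos i.2

lemma joinOpMap_vertex_rev {m n : ℕ} (f : Fin (m + 1) →o Fin (n + 1)) (i : Fin (m + 1)) :
    joinOpMap f (joinVertex i).rev = (joinVertex (f i)).rev := by
  have h : ¬ ((joinVertex i).rev : ℕ) < m + 1 := by
    rw [Fin.val_rev, joinVertex, Fin.val_castLE]
    omega
  refine (dif_neg h).trans ?_
  congr 3
  ext
  simp [joinVertex]

/-- The functor `[n] ↦ [n] ⋆ [n]ᵒᵖ = [2n+1]`. -/
def joinOp : SimplexCategory ⥤ SimplexCategory where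
  obj n := ⦋2 * n.len + 1⦌
  map f := SimplexCategory.Hom.mk (joinOpMap f.toOrderHom)
  map_id n := by
    ext j : 3
    change joinOpMap OrderHom.id j = j
    obtain ⟨i, rfl | rfl⟩ := joinVertex_cases j
    · rw [joinOpMap_vertex]; rfl
    · rw [joinOpMap_vertex_rev]; rfl
  map_comp {m n k} f g := by
    ext j : 3
    change joinOpMap (g.toOrderHom.comp f.toOrderHom) j =
      joinOpMap g.toOrderHom (joinOpMap f.toOrderHom j)
    obtain ⟨i, rfl | rfl⟩ := joinVertex_cases j
    · rw [joinOpMap_vertex, joinOpMap_vertex, joinOpMap_vertex]; rfl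
    · rw [joinOpMap_vertex_rev, joinOpMap_vertex_rev, joinOpMap_vertex_rev]; rfl

/-- The inclusion `[n] ⟶ [n] ⋆ [n]ᵒᵖ` of the first factor. -/
def joinInl : 𝟭 SimplexCategory ⟶ joinOp where
  app n := SimplexCategory.Hom.mk (a := n) (b := ⦋2 * n.len + 1⦌)
    ⟨fun j ↦ joinVertex j, fun _ _ h ↦ joinVertex_mono h⟩
  naturality {m n} f := by
    apply SimplexCategory.Hom.ext
    apply OrderHom.ext
    funext (j : Fin (m.len + 1))
    exact (joinOpMap_vertex f.toOrderHom j).symm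

/-- The inclusion `[n]ᵒᵖ ⟶ [n] ⋆ [n]ᵒᵖ` of the second factor, where the vertex `i` of `[n]ᵒᵖ` is
identified with the vertex `Fin.rev i = n - i` of `rev [n] = [n]`: it sends `n - i` to `i̅`. -/
def joinInr : SimplexCategory.rev ⟶ joinOp where
  app n := SimplexCategory.Hom.mk (a := n) (b := ⦋2 * n.len + 1⦌)
    ⟨fun j ↦ (joinVertex (Fin.rev (n := n.len + 1) j)).rev,
      fun _ _ h ↦ Fin.rev_le_rev.2 (joinVertex_mono (Fin.rev_le_rev.2 h))⟩
  naturality {m n} f := by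
    apply SimplexCategory.Hom.ext
    apply OrderHom.ext
    funext (j : Fin (m.len + 1))
    refine Eq.trans ?_ (joinOpMap_vertex_rev f.toOrderHom j.rev).symm
    change (joinVertex (Fin.rev (Fin.rev (f.toOrderHom j.rev)))).rev = _
    rw [Fin.rev_rev]

/-- The nondegenerate thin `2`-simplices of `Q(n)`: those which factor through `Δ^n` (all
vertices are at most `n`) or `(Δ^n)ᵒᵖ` (all vertices are greater than `n`), and
`Δ^{i,j,k̅}` and `Δ^{k,j̅,i̅}` for `i < j ≤ k ≤ n`, where `i̅ = 2n+1-i`. -/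
def QThin (n : ℕ) : Set ((Δ[2 * n + 1] : SSet.{u}) _⦋2⦌) :=
  {s | ∀ a, (s a : ℕ) ≤ n} ∪ {s | ∀ a, n < (s a : ℕ)} ∪
    {s | ∃ i j k : ℕ, i < j ∧ j ≤ k ∧ k ≤ n ∧
      (s ∈ ScaledSSet.tri (2 * n + 1) i j (2 * n + 1 - k) ∨
        s ∈ ScaledSSet.tri (2 * n + 1) k (2 * n + 1 - j) (2 * n + 1 - i))}

lemma QThin_map {m n : SimplexCategory} (f : m ⟶ n) (s : (Δ[2 * m.len + 1] : SSet.{u}) _⦋2⦌)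
    (hs : s ∈ SSet.degenerate _ 2 ∪ QThin m.len) :
    (SSet.stdSimplex.map (joinOp.map f)).app (op ⦋2⦌) s ∈
      SSet.degenerate _ 2 ∪ QThin n.len := by
  obtain hs | hs := hs
  · exact Or.inl (SSet.degenerate_app_apply hs _)
  set t : (Δ[2 * n.len + 1] : SSet.{u}) _⦋2⦌ :=
    (SSet.stdSimplex.map (joinOp.map f)).app (op ⦋2⦌) s with ht
  have hval (a : Fin 3) : t a = joinOpMap f.toOrderHom (s a) := rfl
  by_cases hd : t ∈ SSet.degenerate _ 2
  · exact Or.inl hd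
  have hmono : StrictMono t := (SSet.stdSimplex.mem_nonDegenerate_iff_strictMono t).1 hd
  have h01 : t 0 < t 1 := hmono (by decide)
  have h12 : t 1 < t 2 := hmono (by decide)
  have hl (a : Fin 3) (i : Fin (m.len + 1)) (h : (s a : ℕ) = i) :
      (t a : ℕ) = f.toOrderHom i := by
    rw [hval, show s a = joinVertex i from Fin.ext h, joinOpMap_vertex]
    rfl
  have hr (a : Fin 3) (i : Fin (m.len + 1)) (h : (s a : ℕ) = 2 * m.len + 1 - i) :
      (t a : ℕ) = 2 * n.len + 1 - f.toOrderHom i := by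
    rw [hval, show s a = (joinVertex i).rev from Fin.ext (by
      rw [h, Fin.val_rev, joinVertex, Fin.val_castLE]; omega), joinOpMap_vertex_rev, Fin.val_rev,
      joinVertex, Fin.val_castLE]
    omega
  refine Or.inr ?_
  obtain (hs | hs) | ⟨i, j, k, hij, hjk, hk, hs⟩ := hs
  · refine Or.inl (Or.inl fun a ↦ ?_)
    rw [hl a ⟨s a, Nat.lt_succ_of_le (hs a)⟩ rfl]
    exact Nat.le_of_lt_succ (Fin.is_lt _)
  · refine Or.inl (Or.inr fun a ↦ ?_)
    have h1 := hs a
    have h2 := (s a).is_lt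
    rw [hr a ⟨2 * m.len + 1 - s a, by omega⟩ (by dsimp only; omega)]
    have := (f.toOrderHom ⟨2 * m.len + 1 - s a, by omega⟩).is_lt
    omega
  · have e1 : f.toOrderHom ⟨i, by omega⟩ ≤ f.toOrderHom ⟨j, by omega⟩ :=
      f.toOrderHom.monotone hij.le
    have e2 : f.toOrderHom ⟨j, by omega⟩ ≤ f.toOrderHom ⟨k, by omega⟩ :=
      f.toOrderHom.monotone hjk
    have e3 := (f.toOrderHom ⟨k, by omega⟩).is_lt
    rw [Fin.le_def] at e1 e2
    rw [Fin.lt_def] at h01 h12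
    refine Or.inr ⟨f.toOrderHom ⟨i, by omega⟩, f.toOrderHom ⟨j, by omega⟩,
      f.toOrderHom ⟨k, by omega⟩, ?_, e2, by omega, ?_⟩
    · obtain ⟨h0, h1, h2⟩ | ⟨h0, h1, h2⟩ := hs
      · rw [hl 0 ⟨i, by omega⟩ h0, hl 1 ⟨j, by omega⟩ h1] at h01
        exact h01
      · rw [hr 1 ⟨j, by omega⟩ h1, hr 2 ⟨i, by omega⟩ h2] at h12
        omega
    · obtain ⟨h0, h1, h2⟩ | ⟨h0, h1, h2⟩ := hs
      · exact Or.inl ⟨hl 0 ⟨i, by omega⟩ h0, hl 1 ⟨j, by omega⟩ h1, hr 2 ⟨k, by omega⟩ h2⟩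
      · exact Or.inr ⟨hl 0 ⟨k, by omega⟩ h0, hr 1 ⟨j, by omega⟩ h1, hr 2 ⟨i, by omega⟩ h2⟩

/-- The cosimplicial scaled simplicial set `[n] ↦ Q(n) = Δ^n ⋆ (Δ^n)ᵒᵖ`. -/
def Q : SimplexCategory ⥤ ScaledSSet.{u} where
  obj n := ScaledSSet.generated Δ[2 * n.len + 1] (QThin n.len)
  map {m n} f := ScaledSSet.Hom.mk (SSet.stdSimplex.map (joinOp.map f)) (QThin_map f)
  map_id n := by
    apply ScaledSSet.hom_ext
    change SSet.stdSimplex.map (joinOp.map (𝟙 n)) = 𝟙 _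
    rw [joinOp.map_id]
    exact SSet.stdSimplex.map_id _
  map_comp f g := by
    apply ScaledSSet.hom_ext
    change SSet.stdSimplex.map (joinOp.map (f ≫ g)) =
      SSet.stdSimplex.map (joinOp.map f) ≫ SSet.stdSimplex.map (joinOp.map g)
    rw [joinOp.map_comp]
    exact SSet.stdSimplex.map_comp _ _

/-- The nerve `Q^* C` associated with `Q`: its `n`-simplices are the maps `Q(n) ⟶ C`. -/
def QNerve (C : ScaledSSet.{u}) : SSet.{u} :=
  Q.op ⋙ yoneda.obj C

/-! ### Marked simplicial sets and Cartesian fibrations -/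

/-- A marked simplicial set: a simplicial set with a set of edges, called marked, which contains
all the degenerate ones. -/
structure MarkedSSet where
  /-- the underlying simplicial set -/
  toSSet : SSet.{u}
  /-- the marked edges -/
  marked : Set (toSSet _⦋1⦌)
  degenerate_subset_marked : toSSet.degenerate 1 ⊆ marked

namespace SSet

/-- An edge `e` of `X` is `p`-Cartesian, where `p : X ⟶ S`: for all `n ≥ 2` (here `n = k + 2`),
every lifting problem of `Λ^n_n ⟶ Δ^n` against `p` in which `Λ^n_n ⟶ X` sends the last edge
`Δ^{n-1,n}` to `e` has a solution. -/
def IsCartesianEdge {X S : SSet.{u}} (p : X ⟶ S) (e : X _⦋1⦌) : Prop :=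
  ∀ (k : ℕ) (f : (Λ[k + 2, Fin.last (k + 2)] : SSet.{u}) ⟶ X) (g : Δ[k + 2] ⟶ S),
    f ≫ p = Λ[k + 2, Fin.last (k + 2)].ι ≫ g →
    f.app (op ⦋1⦌) (horn.edge (k + 2) (Fin.last (k + 2)) (Fin.last (k + 1)).castSucc
      (Fin.last (k + 2)) (Fin.le_last _)
      (by rw [Finset.insert_eq_of_mem (by simp)]; exact Finset.card_le_two.trans (by omega))) = e →
    ∃ h : Δ[k + 2] ⟶ X, Λ[k + 2, Fin.last (k + 2)].ι ≫ h = f ∧ h ≫ p = g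

/-- A map `p : X ⟶ S` is a Cartesian fibration: it is an inner fibration, and for every
vertex `x` of `X` and every edge `f` of `S` with target `p x` there is a `p`-Cartesian edge
of `X` with target `x` over `f`. (The target of an edge is its image under `δ 0`.) -/
structure IsCartesianFibration {X S : SSet.{u}} (p : X ⟶ S) : Prop where
  innerFibration : InnerFibration p
  exists_cartesianEdge : ∀ (x : X _⦋0⦌) (f : S _⦋1⦌), S.δ 0 f = p.app (op ⦋0⦌) x →
    ∃ e : X _⦋1⦌, IsCartesianEdge p e ∧ X.δ 0 e = x ∧ p.app (op ⦋1⦌) e = f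

end SSet

/-! ### The enhanced twisted arrow category -/

/-- The enhanced twisted arrow category `Tw(C) = (Q^* C, E)`, where `E` consists of the edges
`Q(1) ⟶ C` which factor through a map `Δ^3_♯ ⟶ C`. -/
def Tw (C : ScaledSSet.{u}) : MarkedSSet.{u} where
  toSSet := QNerve C
  marked := {e | ∃ g : ScaledSSet.sharp (Δ[3] : SSet.{u}) ⟶ C,
    ScaledSSet.toSharp (Q.obj ⦋1⦌) ≫ g = e}
  degenerate_subset_marked := by
    intro e he
    rw [SSet.degenerate_eq_iUnion_range_σ, Set.mem_iUnion] at he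
    obtain ⟨i, x, rfl⟩ := he
    refine ⟨ScaledSSet.Hom.mk (SSet.stdSimplex.map (joinOp.map (SimplexCategory.σ i)) ≫
      ScaledSSet.Hom.toSSetHom (X := Q.obj ⦋0⦌) (Y := C) x) fun y _ ↦ ScaledSSet.Hom.map_thin x _ (Or.inl ?_), rfl⟩
    change _ ∈ SSet.degenerate (Δ[1] : SSet.{u}) 2
    rw [SSet.degenerate_eq_univ_of_hasDimensionLT _ 2 2 le_rfl]
    exact Set.mem_univ _

/-- For `f : [l] ⟶ [2n+1]` and a map `Q(n) ⟶ C`, the image of the simplex `f` of `Q(n)`. -/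
def QEval {C : ScaledSSet.{u}} {n l : SimplexCategory} (x : Q.obj n ⟶ C) (f : l ⟶ joinOp.obj n) :
    C.toSSet.obj (op l) :=
  (ScaledSSet.Hom.toSSetHom x).app (op l) (SSet.stdSimplex.objEquiv.symm f)

lemma map_QEval {C : ScaledSSet.{u}} {n l k : SimplexCategory} (x : Q.obj n ⟶ C)
    (f : l ⟶ joinOp.obj n) (g : k ⟶ l) :
    C.toSSet.map g.op (QEval x f) = QEval x (g ≫ f) :=
  ((ScaledSSet.Hom.toSSetHom x).naturality_apply g.op _).symm

lemma QEval_map {C : ScaledSSet.{u}} {m n l : SimplexCategory} (x : Q.obj n ⟶ C)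
    (g : m ⟶ n) (f : l ⟶ joinOp.obj m) :
    QEval (Q.map g ≫ x) f = QEval x (f ≫ joinOp.map g) :=
  rfl

/-- The inclusion `Δ^n_♯ ⊆ Q(n)` is a map of scaled simplicial sets, so that `QEval x` sends it
to a simplex of the underlying `∞`-category. -/
lemma QEval_joinInl_mem {C : ScaledSSet.{u}} {n : SimplexCategory} (x : Q.obj n ⟶ C) :
    QEval x (joinInl.app n) ∈ C.underlying.obj (op n) := by
  intro f
  rw [map_QEval]
  refine ScaledSSet.Hom.map_thin x _ (Or.inr (Or.inl (Or.inl fun a ↦ ?_)))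
  exact Nat.le_of_lt_succ (f.toOrderHom a).is_lt

/-- The inclusion `(Δ^n)ᵒᵖ_♯ ⊆ Q(n)` is a map of scaled simplicial sets, so that `QEval x` sends it
to a simplex of the underlying `∞`-category. -/
lemma QEval_joinInr_mem {C : ScaledSSet.{u}} {n : SimplexCategory} (x : Q.obj n ⟶ C) :
    QEval x (joinInr.app n) ∈ C.underlying.obj (op n) := by
  intro f
  rw [map_QEval]
  refine ScaledSSet.Hom.map_thin x _ (Or.inr (Or.inl (Or.inr fun a ↦ ?_)))
  exact lt_joinVertex_rev (Fin.rev (f.toOrderHom a) : Fin (n.len + 1))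

/-- The map `Tw(C) ⟶ 𝒞` induced by the inclusions `Δ^n ⊆ Q(n)`. -/
def twFst (C : ScaledSSet.{u}) : (Tw C).toSSet ⟶ (C.underlying : SSet.{u}) where
  app k := TypeCat.ofHom fun x ↦ ⟨QEval x (joinInl.app k.unop), QEval_joinInl_mem x⟩
  naturality k l f := by
    ext (x : Q.obj k.unop ⟶ C)
    apply Subtype.ext
    change QEval (Q.map f.unop ≫ x) _ = C.toSSet.map f (QEval x _)
    rw [QEval_map, ← joinInl.naturality]
    exact (map_QEval x _ f.unop).symm

/-- The map `Tw(C) ⟶ 𝒞ᵒᵖ` induced by the inclusions `(Δ^n)ᵒᵖ ⊆ Q(n)`. -/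
def twSnd (C : ScaledSSet.{u}) : (Tw C).toSSet ⟶ (C.underlying : SSet.{u}).op where
  app k := TypeCat.ofHom fun x ↦
    SSet.opObjEquiv.symm ⟨QEval x (joinInr.app k.unop), QEval_joinInr_mem x⟩
  naturality k l f := by
    ext (x : Q.obj k.unop ⟶ C)
    apply Subtype.ext
    change QEval (Q.map f.unop ≫ x) _ =
      C.toSSet.map (SimplexCategory.rev.map f.unop).op (QEval x (joinInr.app k.unop))
    rw [QEval_map, ← joinInr.naturality]
    exact (map_QEval x (joinInr.app k.unop) (SimplexCategory.rev.map f.unop)).symm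

/-- The canonical map `Tw(C) ⟶ 𝒞 × 𝒞ᵒᵖ`. -/
def twProj (C : ScaledSSet.{u}) :
    (Tw C).toSSet ⟶ (C.underlying : SSet.{u}) ⊗ (C.underlying : SSet.{u}).op :=
  CartesianMonoidalCategory.lift (twFst C) (twSnd C)

/-!
Let `C` be an `∞`-bicategory. A lifting problem of `Λ^n_i ⟶ Δ^n` against `Tw(C) ⟶ 𝒞 × 𝒞ᵒᵖ` amounts
to extending to `Q(n)` a map to `C` which is defined on the simplices of `Δ^{2n+1} = Δ^n ⋆
(Δ^n)ᵒᵖ` that lie in `Δ^n`, in `(Δ^n)ᵒᵖ` or in `Δ^σ ⋆ (Δ^σ)ᵒᵖ` for a simplex `σ` of the horn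
(`TwHorn.partialSimplex`). A nondegenerate simplex of `Δ^{2n+1}` is a set of vertices `A ∪ B` with
`A ⊆ [n]` and `B ⊆ [n]ᵒᵖ`; the missing ones are those with `A`, `B` nonempty for which each `j ≠
i` in `[n]` is in `A`, or `j̅` is in `B` (`not_isHornSimplex_iff`).

For `0 < i ≤ n` the missing simplices can be added in pairs, by inner horn fillings. If `i - 1` is
not in `A`, then its copy `i - 1` in `[n]ᵒᵖ` is in `B`, and the simplices with and without the
vertex `i̅` are paired (`isPivot_rev`). If `i - 1` is in `A`, those with and without the vertex
`i` of `[n]` are paired (`isPivot`). The first kind is added before the second, and each kind in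
the order of dimension (`PartialSimplex.exists_extends_of_toggle`). The horn fillings are allowed
as the triangle spanned by the toggled vertex and its two neighbours is thin. When the free face
of the filled simplex is a triangle which has to be thin, the remaining three faces of the
`3`-simplex are thin; the free one is then thin by saturation, applied to a degenerate `4`-simplex
(`ScaledSSet.isThinTriangle_zero_two_three`, `ScaledSSet.isThinTriangle_zero_one_three`).

If `i < n`, this works with the scaling of `Q(n)`. If `i = n`, it requires a larger scaling,
consisting of the triangles which become thin or degenerate when `n` is identified with `n - 1`
(`twScaling`). If `n ≥ 2` and the last edge of the horn is marked, then the given map respects the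
larger scaling (`PartialSimplex.respectsScaling_last`), so that marked edges are Cartesian. If `n
= 1`, the larger scaling consists of all triangles of `Δ^3`, and there is no condition on the
given map. Hence each edge of `𝒞 × 𝒞ᵒᵖ` whose target is lifted has a marked lift with this target
(`exists_marked_lift`).
-/

open SimplexCategory

/-! ### Simplices of a standard simplex and their vertices -/

namespace SimplexCategory

/-- The set of vertices of the simplex `s` of the standard simplex `Δ^l`. -/
def supp {k l : SimplexCategory} (s : k ⟶ l) : Finset (Fin (l.len + 1)) :=
  Finset.univ.image s.toOrderHom

lemma mem_supp {k l : SimplexCategory} {s : k ⟶ l} {x : Fin (l.len + 1)} :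
    x ∈ supp s ↔ ∃ i, s.toOrderHom i = x := by
  simp [supp]

lemma apply_mem_supp {k l : SimplexCategory} (s : k ⟶ l) (i : Fin (k.len + 1)) :
    s.toOrderHom i ∈ supp s :=
  mem_supp.2 ⟨i, rfl⟩

lemma supp_comp_subset {j k l : SimplexCategory} (g : j ⟶ k) (s : k ⟶ l) :
    supp (g ≫ s) ⊆ supp s := by
  intro x hx
  obtain ⟨i, rfl⟩ := mem_supp.1 hx
  exact mem_supp.2 ⟨g.toOrderHom i, rfl⟩

lemma comp_left_injective {j k l : SimplexCategory} {e : k ⟶ l}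
    (he : Function.Injective e.toOrderHom) {s t : j ⟶ k} (h : s ≫ e = t ≫ e) : s = t := by
  apply SimplexCategory.Hom.ext
  apply OrderHom.ext
  funext i
  apply he
  exact congrArg (fun f : j ⟶ l ↦ f.toOrderHom i) h

/-- A simplex all of whose vertices are vertices of a nondegenerate simplex `e` is a simplex
of `e`. -/
lemma exists_comp_eq {j k l : SimplexCategory} {e : k ⟶ l}
    (he : Function.Injective e.toOrderHom) (s : j ⟶ l) (h : supp s ⊆ supp e) :
    ∃ t : j ⟶ k, t ≫ e = s := by
  have hmono : StrictMono e.toOrderHom := e.toOrderHom.monotone.strictMono_of_injective he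
  choose t ht using fun i ↦ mem_supp.1 (h (apply_mem_supp s i))
  refine ⟨SimplexCategory.Hom.mk ⟨t, fun a b hab ↦ ?_⟩, ?_⟩
  · rw [← hmono.le_iff_le, ht, ht]
    exact s.toOrderHom.monotone hab
  · apply SimplexCategory.Hom.ext
    apply OrderHom.ext
    funext i
    exact ht i

/-- Every nonempty set of vertices is the set of vertices of a nondegenerate simplex. -/
lemma exists_supp_eq {l : SimplexCategory} (S : Finset (Fin (l.len + 1))) {m : ℕ}
    (hS : S.card = m + 1) :
    ∃ e : ⦋m⦌ ⟶ l, Function.Injective e.toOrderHom ∧ supp e = S :=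
  ⟨SimplexCategory.Hom.mk (S.orderEmbOfFin hS).toOrderHom, (S.orderEmbOfFin hS).injective,
    S.image_orderEmbOfFin_univ hS⟩

end SimplexCategory

lemma SSet.objEquiv_symm_mem_horn_iff {m : ℕ} {k : Fin (m + 1)} {l : SimplexCategory}
    (s : l ⟶ ⦋m⦌) :
    SSet.stdSimplex.objEquiv.symm s ∈ (Λ[m, k] : SSet.Subcomplex.{u} _).obj (op l) ↔
      ∃ j, j ≠ k ∧ j ∉ supp s := by
  rw [SSet.mem_horn_iff, Ne, Set.eq_univ_iff_forall, not_forall]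
  refine exists_congr fun j ↦ ?_
  rw [Set.mem_union, not_or, and_comm]
  exact and_congr Iff.rfl (not_congr mem_supp.symm)

lemma SSet.app_objEquiv_symm {X : SSet.{u}} {l n : SimplexCategory}
    (f : SSet.stdSimplex.obj n ⟶ X) (s : l ⟶ n) :
    f.app (op l) (SSet.stdSimplex.objEquiv.symm s) =
      X.map s.op (f.app (op n) (SSet.stdSimplex.objEquiv.symm (𝟙 n))) := by
  obtain ⟨x, rfl⟩ := SSet.yonedaEquiv.symm.surjective f
  change X.map s.op x = X.map s.op (X.map (𝟙 n).op x)
  simp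

/-! ### Partially defined simplices -/

/-- A map to `X` from the simplicial subset of `Δ^N` which consists of the simplices whose set of
vertices satisfies `P`. (This is meant for predicates `P` which are closed under passing to
subsets.) -/
structure PartialSimplex (X : SSet.{u}) (N : ℕ) (P : Finset (Fin (N + 1)) → Prop) where
  /-- the image of a simplex -/
  val : ∀ {l : SimplexCategory} (s : l ⟶ ⦋N⦌), P (supp s) → X.obj (op l)
  map_val : ∀ {k l : SimplexCategory} (g : k ⟶ l) (s : l ⟶ ⦋N⦌) (hs : P (supp s))
    (hgs : P (supp (g ≫ s))), X.map g.op (val s hs) = val (g ≫ s) hgs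

namespace PartialSimplex

variable {X : SSet.{u}} {N : ℕ} {P P' : Finset (Fin (N + 1)) → Prop}

lemma val_congr (M : PartialSimplex X N P) {l : SimplexCategory} {s t : l ⟶ ⦋N⦌} (h : s = t)
    (hs : P (supp s)) : M.val s hs = M.val t (h ▸ hs) := by
  subst h
  rfl

/-- `M'` extends `M`. -/
def Extends (M' : PartialSimplex X N P') (M : PartialSimplex X N P) : Prop :=
  ∀ ⦃l : SimplexCategory⦄ (s : l ⟶ ⦋N⦌) (hs : P (supp s)) (hs' : P' (supp s)),
    M'.val s hs' = M.val s hs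

/-- The map given by a functional relation between simplices of `Δ^N` and of `X` which is
compatible with the simplicial operators. -/
noncomputable def ofRel (R : ∀ ⦃l : SimplexCategory⦄, (l ⟶ ⦋N⦌) → X.obj (op l) → Prop)
    (hex : ∀ ⦃l : SimplexCategory⦄ (s : l ⟶ ⦋N⦌), P (supp s) → ∃ y, R s y)
    (huniq : ∀ ⦃l : SimplexCategory⦄ (s : l ⟶ ⦋N⦌) y y', R s y → R s y' → y = y')
    (hmap : ∀ ⦃k l : SimplexCategory⦄ (g : k ⟶ l) (s : l ⟶ ⦋N⦌) y, R s y →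
      R (g ≫ s) (X.map g.op y)) : PartialSimplex X N P where
  val s hs := (hex s hs).choose
  map_val g s hs hgs := huniq _ _ _ (hmap g s _ (hex s hs).choose_spec) (hex _ hgs).choose_spec

/-- The pullback along `e : Δ^m ⟶ Δ^N`. -/
def pullback (M : PartialSimplex X N P) {m : ℕ} {R : Finset (Fin (m + 1)) → Prop}
    (e : ⦋m⦌ ⟶ ⦋N⦌) (h : ∀ ⦃l : SimplexCategory⦄ (t : l ⟶ ⦋m⦌), R (supp t) → P (supp (t ≫ e))) :
    PartialSimplex X m R where
  val t ht := M.val (t ≫ e) (h t ht)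
  map_val g t ht hgt := M.map_val g (t ≫ e) (h t ht) (h _ hgt)

variable {C : ScaledSSet.{u}}

/-- The triangle `Δ^{a,b,c}` is sent to a thin triangle, if it lies in the domain. -/
def IsThinAt (M : PartialSimplex C.toSSet N P) (a b c : ℕ) : Prop :=
  ∀ (s : ⦋2⦌ ⟶ ⦋N⦌) (hs : P (supp s)), (s.toOrderHom 0 : ℕ) = a → (s.toOrderHom 1 : ℕ) = b →
    (s.toOrderHom 2 : ℕ) = c → M.val s hs ∈ C.thin

/-- The nondegenerate triangles in `T` are sent to thin triangles. -/
def RespectsScaling (M : PartialSimplex C.toSSet N P) (T : ℕ → ℕ → ℕ → Prop) : Prop :=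
  ∀ ⦃a b c : ℕ⦄, a < b → b < c → T a b c → M.IsThinAt a b c

end PartialSimplex

/-! ### Elementary forms of the extension property -/

namespace ScaledSSet

variable (C : ScaledSSet.{u})

/-- The elementary form of the extension property for inner horns. -/
lemma exists_inner_filler [IsInftyBicategory C] {m : ℕ} (k : Fin (m + 1)) (h0 : 0 < k)
    (hm : k < Fin.last m) (M : PartialSimplex C.toSSet m fun S ↦ ∃ j, j ≠ k ∧ j ∉ S)
    (hM : M.IsThinAt (k - 1) k (k + 1)) :
    ∃ y : C.toSSet.obj (op ⦋m⦌),
      (∀ ⦃l : SimplexCategory⦄ (s : l ⟶ ⦋m⦌) hs, C.toSSet.map s.op y = M.val s hs) ∧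
      ∀ s : ⦋2⦌ ⟶ ⦋m⦌, (s.toOrderHom 0 : ℕ) = k - 1 → (s.toOrderHom 1 : ℕ) = k →
        (s.toOrderHom 2 : ℕ) = k + 1 → C.toSSet.map s.op y ∈ C.thin := by
  have hmem {l : SimplexCategoryᵒᵖ} (x : (Λ[m, k] : SSet.{u}).obj l) :
      ∃ j, j ≠ k ∧ j ∉ supp (SSet.stdSimplex.objEquiv x.1) :=
    (SSet.objEquiv_symm_mem_horn_iff.{u} _).1 x.2
  let φ : (Λ[m, k] : SSet.{u}) ⟶ C.toSSet :=
    { app := fun l ↦ TypeCat.ofHom fun x ↦ M.val (SSet.stdSimplex.objEquiv x.1) (hmem x)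
      naturality := fun l l' g ↦ by
        ext x
        exact (M.map_val g.unop _ (hmem x) _).symm }
  let ψ : (generated Δ[m] (tri m ((k : ℕ) - 1) (k : ℕ) ((k : ℕ) + 1))).restrict Λ[m, k] ⟶ C :=
    Hom.mk φ fun x hx ↦ by
      obtain hx | hx := hx
      · refine C.degenerate_subset_thin (SSet.degenerate_app_apply ?_ φ)
        exact (SSet.Subcomplex.mem_degenerate_iff _ x).2 hx
      · exact hM _ (hmem x) hx.1 hx.2.1 hx.2.2
  obtain ⟨Ψ, hΨ⟩ := IsInftyBicategory.exists_extension _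
    (GeneratingScaledAnodyne.innerHorn m k h0 hm) ψ
  have hnat {l : SimplexCategory} (s : l ⟶ ⦋m⦌) :
      C.toSSet.map s.op
        ((Hom.toSSetHom Ψ).app (op ⦋m⦌) (SSet.stdSimplex.objEquiv.symm (𝟙 ⦋m⦌))) =
      (Hom.toSSetHom Ψ).app (op l) (SSet.stdSimplex.objEquiv.symm s) :=
    (SSet.app_objEquiv_symm (Hom.toSSetHom Ψ) s).symm
  refine ⟨(Hom.toSSetHom Ψ).app (op ⦋m⦌) (SSet.stdSimplex.objEquiv.symm (𝟙 ⦋m⦌)), ?_, ?_⟩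
  · intro l s hs
    let x : (Λ[m, k] : SSet.{u}).obj (op l) := 
      ⟨SSet.stdSimplex.objEquiv.symm s, (SSet.objEquiv_symm_mem_horn_iff s).2 hs⟩
    exact (hnat s).trans (congrArg (fun q ↦ (Hom.toSSetHom q).app (op l) x) hΨ)
  · intro s hs0 hs1 hs2
    exact (congrArg (· ∈ C.thin) (hnat s)).mpr (Hom.map_thin Ψ _ (Or.inr ⟨hs0, hs1, hs2⟩))

/-- A map from the `4`-simplex which sends the triangles in the smaller scaling of the saturation
generator to thin triangles does so for `Δ^{0,3,4}` and `Δ^{0,1,4}`. -/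
lemma saturation_thin [IsInftyBicategory C] (z : C.toSSet.obj (op ⦋4⦌))
    (hz : ∀ s : ⦋2⦌ ⟶ ⦋4⦌, (SSet.stdSimplex.objEquiv.symm s : (Δ[4] : SSet.{u}) _⦋2⦌) ∈
      tri 4 0 2 4 ∪ tri 4 1 2 3 ∪ tri 4 0 1 3 ∪ tri 4 1 3 4 ∪ tri 4 0 1 2 →
      C.toSSet.map s.op z ∈ C.thin) (s : ⦋2⦌ ⟶ ⦋4⦌)
    (hs : (SSet.stdSimplex.objEquiv.symm s : (Δ[4] : SSet.{u}) _⦋2⦌) ∈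
      tri 4 0 3 4 ∪ tri 4 0 1 4) : C.toSSet.map s.op z ∈ C.thin := by
  let ψ : generated Δ[4]
      (tri 4 0 2 4 ∪ tri 4 1 2 3 ∪ tri 4 0 1 3 ∪ tri 4 1 3 4 ∪ tri 4 0 1 2) ⟶ C :=
    Hom.mk (SSet.yonedaEquiv.symm z) fun x hx ↦ by
      obtain hx | hx := hx
      · exact C.degenerate_subset_thin (SSet.degenerate_app_apply hx _)
      · exact hz (SSet.stdSimplex.objEquiv x) hx
  obtain ⟨Ψ, hΨ⟩ := IsInftyBicategory.exists_extension _ GeneratingScaledAnodyne.saturation ψ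
  have h := Hom.map_thin Ψ (SSet.stdSimplex.objEquiv.symm s) (Or.inr (Or.inr hs))
  have h' : (Hom.toSSetHom Ψ).app (op ⦋2⦌) (SSet.stdSimplex.objEquiv.symm s) =
      C.toSSet.map s.op z :=
    congrArg (fun q ↦ (Hom.toSSetHom q).app (op ⦋2⦌) (SSet.stdSimplex.objEquiv.symm s)) hΨ
  rwa [h'] at h

/-- The triangle `Δ^{a,b,c}` of a simplex is thin. -/
def IsThinTriangle {C : ScaledSSet.{u}} {m : ℕ} (y : C.toSSet.obj (op ⦋m⦌)) (a b c : ℕ) : Prop :=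
  ∀ s : ⦋2⦌ ⟶ ⦋m⦌, (s.toOrderHom 0 : ℕ) = a → (s.toOrderHom 1 : ℕ) = b →
    (s.toOrderHom 2 : ℕ) = c → C.toSSet.map s.op y ∈ C.thin

variable {C}

lemma map_mem_thin_of_not_injective {l : SimplexCategory}
    (y : C.toSSet.obj (op l)) (s : ⦋2⦌ ⟶ l) (hs : ¬ Function.Injective s.toOrderHom) :
    C.toSSet.map s.op y ∈ C.thin := by
  refine C.degenerate_subset_thin ?_
  have h : (SSet.stdSimplex.objEquiv.symm s : (SSet.stdSimplex.{u}.obj l).obj (op ⦋2⦌)) ∈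
      (SSet.stdSimplex.{u}.obj l).degenerate 2 := by
    by_contra h
    exact hs ((SSet.stdSimplex.mem_nonDegenerate_iff_strictMono (n := l.len) _).1 h).injective
  exact SSet.degenerate_app_apply h (SSet.yonedaEquiv.symm y)

lemma isThinTriangle_of_eq {m : ℕ} (y : C.toSSet.obj (op ⦋m⦌)) {a b c : ℕ}
    (h : a = b ∨ b = c) : IsThinTriangle y a b c := by
  intro s h0 h1 h2
  refine map_mem_thin_of_not_injective y s fun hs ↦ ?_
  obtain h | h := h
  · exact absurd (hs (Fin.ext (h0.trans (h.trans h1.symm)))) (by decide)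
  · exact absurd (hs (Fin.ext (h1.trans (h.trans h2.symm)))) (by decide)

lemma IsThinTriangle.map {m k : ℕ} {y : C.toSSet.obj (op ⦋m⦌)} (p : ⦋k⦌ ⟶ ⦋m⦌)
    {a b c : Fin (k + 1)}
    (h : IsThinTriangle y (p.toOrderHom a) (p.toOrderHom b) (p.toOrderHom c)) :
    IsThinTriangle (C.toSSet.map p.op y) a b c := by
  intro s h0 h1 h2
  rw [← Functor.map_comp_apply, ← op_comp]
  exact h (s ≫ p) (congrArg (fun x ↦ (p.toOrderHom x : ℕ)) (Fin.ext h0))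
    (congrArg (fun x ↦ (p.toOrderHom x : ℕ)) (Fin.ext h1))
    (congrArg (fun x ↦ (p.toOrderHom x : ℕ)) (Fin.ext h2))

variable [IsInftyBicategory C]

lemma isThinTriangle_of_saturation {z : C.toSSet.obj (op ⦋4⦌)}
    (h₁ : IsThinTriangle z 0 2 4) (h₂ : IsThinTriangle z 1 2 3) (h₃ : IsThinTriangle z 0 1 3)
    (h₄ : IsThinTriangle z 1 3 4) (h₅ : IsThinTriangle z 0 1 2) :
    IsThinTriangle z 0 3 4 ∧ IsThinTriangle z 0 1 4 := by
  have key := C.saturation_thin z (by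
    rintro s ((((h | h) | h) | h) | h)
    · exact h₁ s h.1 h.2.1 h.2.2
    · exact h₂ s h.1 h.2.1 h.2.2
    · exact h₃ s h.1 h.2.1 h.2.2
    · exact h₄ s h.1 h.2.1 h.2.2
    · exact h₅ s h.1 h.2.1 h.2.2)
  exact ⟨fun s h0 h1 h2 ↦ key s (Or.inl ⟨h0, h1, h2⟩), fun s h0 h1 h2 ↦ key s (Or.inr ⟨h0, h1, h2⟩)⟩

/-- If the faces of a `3`-simplex other than the one opposite to the vertex `1` are thin, then so
is that one: saturation applies to the degenerate `4`-simplex with vertices `0, 1, 1, 2, 3`. -/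
lemma isThinTriangle_zero_two_three {y : C.toSSet.obj (op ⦋3⦌)}
    (h₀ : IsThinTriangle y 0 1 2) (h₁ : IsThinTriangle y 0 1 3) (h₂ : IsThinTriangle y 1 2 3) :
    IsThinTriangle y 0 2 3 := by
  let p : ⦋4⦌ ⟶ ⦋3⦌ := SimplexCategory.σ (1 : Fin 4)
  have key := (isThinTriangle_of_saturation (z := C.toSSet.map p.op y)
    (IsThinTriangle.map p (a := 0) (b := 2) (c := 4) h₁)
    (IsThinTriangle.map p (a := 1) (b := 2) (c := 3) (isThinTriangle_of_eq y (Or.inl rfl)))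
    (IsThinTriangle.map p (a := 0) (b := 1) (c := 3) h₀)
    (IsThinTriangle.map p (a := 1) (b := 3) (c := 4) h₂)
    (IsThinTriangle.map p (a := 0) (b := 1) (c := 2) (isThinTriangle_of_eq y (Or.inr rfl)))).1
  have hp : SimplexCategory.δ (1 : Fin 5) ≫ p = 𝟙 _ := SimplexCategory.δ_comp_σ_self (i := 1)
  have key' := IsThinTriangle.map (SimplexCategory.δ (1 : Fin 5)) (a := 0) (b := 2) (c := 3) key
  rwa [← Functor.map_comp_apply, ← op_comp, hp, op_id, Functor.map_id_apply] at key'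

/-- If the faces of a `3`-simplex other than the one opposite to the vertex `2` are thin, then so
is that one: saturation applies to the degenerate `4`-simplex with vertices `0, 1, 2, 2, 3`. -/
lemma isThinTriangle_zero_one_three {y : C.toSSet.obj (op ⦋3⦌)}
    (h₀ : IsThinTriangle y 0 1 2) (h₁ : IsThinTriangle y 0 2 3) (h₂ : IsThinTriangle y 1 2 3) :
    IsThinTriangle y 0 1 3 := by
  let p : ⦋4⦌ ⟶ ⦋3⦌ := SimplexCategory.σ (2 : Fin 4)
  have key := (isThinTriangle_of_saturation (z := C.toSSet.map p.op y)
    (IsThinTriangle.map p (a := 0) (b := 2) (c := 4) h₁)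
    (IsThinTriangle.map p (a := 1) (b := 2) (c := 3) (isThinTriangle_of_eq y (Or.inr rfl)))
    (IsThinTriangle.map p (a := 0) (b := 1) (c := 3) h₀)
    (IsThinTriangle.map p (a := 1) (b := 3) (c := 4) h₂)
    (IsThinTriangle.map p (a := 0) (b := 1) (c := 2) h₀)).2
  have hp : SimplexCategory.δ (2 : Fin 5) ≫ p = 𝟙 _ := SimplexCategory.δ_comp_σ_self (i := 2)
  have key' := IsThinTriangle.map (SimplexCategory.δ (2 : Fin 5)) (a := 0) (b := 1) (c := 3) key
  rwa [← Functor.map_comp_apply, ← op_comp, hp, op_id, Functor.map_id_apply] at key'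

end ScaledSSet

namespace PartialSimplex

variable {X : SSet.{u}} {N : ℕ} {P P' P'' : Finset (Fin (N + 1)) → Prop}

lemma Extends.trans {M'' : PartialSimplex X N P''} {M' : PartialSimplex X N P'}
    {M : PartialSimplex X N P} (h' : M''.Extends M') (h : M'.Extends M)
    (hP : ∀ S, P S → P' S) : M''.Extends M :=
  fun _ s hs hs'' ↦ (h' s (hP _ hs) hs'').trans (h s hs _)

lemma rel_val {R : ∀ ⦃l : SimplexCategory⦄, (l ⟶ ⦋N⦌) → X.obj (op l) → Prop} {hex huniq hmap}
    {l : SimplexCategory} (s : l ⟶ ⦋N⦌) (hs : P (supp s)) :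
    R s ((ofRel R hex huniq hmap : PartialSimplex X N P).val s hs) :=
  (hex s hs).choose_spec

variable {C : ScaledSSet.{u}}

/-- A simplex in the domain determines a map from a standard simplex, and the triangles of the
latter are thin as soon as their images are. -/
lemma IsThinAt.isThinTriangle {M : PartialSimplex C.toSSet N P}
    (hP : ∀ ⦃S S'⦄, S ⊆ S' → P S' → P S) {m : ℕ} (w : ⦋m⦌ ⟶ ⦋N⦌) (hw : P (supp w))
    {a b c : Fin (m + 1)}
    (h : M.IsThinAt (w.toOrderHom a) (w.toOrderHom b) (w.toOrderHom c)) :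
    ScaledSSet.IsThinTriangle (M.val w hw) a b c := by
  intro s h0 h1 h2
  rw [M.map_val s w hw (hP (supp_comp_subset s w) hw)]
  exact h (s ≫ w) _ (congrArg (fun x ↦ (w.toOrderHom x : ℕ)) (Fin.ext h0))
    (congrArg (fun x ↦ (w.toOrderHom x : ℕ)) (Fin.ext h1))
    (congrArg (fun x ↦ (w.toOrderHom x : ℕ)) (Fin.ext h2))

lemma isThinAt_of_isThinTriangle {M : PartialSimplex C.toSSet N P}
    {m : ℕ} {w : ⦋m⦌ ⟶ ⦋N⦌} (hinj : Function.Injective w.toOrderHom) {hw : P (supp w)}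
    {a b c : Fin (m + 1)} (h : ScaledSSet.IsThinTriangle (M.val w hw) a b c) :
    M.IsThinAt (w.toOrderHom a) (w.toOrderHom b) (w.toOrderHom c) := by
  intro s hs h0 h1 h2
  obtain ⟨t, rfl⟩ := exists_comp_eq hinj s fun x hx ↦ by
    obtain ⟨i, rfl⟩ := mem_supp.1 hx
    revert i
    change ∀ i : Fin 3, _
    intro i _
    fin_cases i
    · exact mem_supp.2 ⟨a, (Fin.ext h0).symm⟩
    · exact mem_supp.2 ⟨b, (Fin.ext h1).symm⟩
    · exact mem_supp.2 ⟨c, (Fin.ext h2).symm⟩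
  rw [← M.map_val t w hw hs]
  exact h t (congrArg Fin.val (hinj (Fin.ext h0))) (congrArg Fin.val (hinj (Fin.ext h1)))
    (congrArg Fin.val (hinj (Fin.ext h2)))

lemma supp_eq_triple {l : SimplexCategory} (s : ⦋2⦌ ⟶ l) :
    supp s = {s.toOrderHom 0, s.toOrderHom 1, s.toOrderHom 2} := by
  ext x
  simp only [mem_supp, Finset.mem_insert, Finset.mem_singleton]
  change (∃ i : Fin 3, _) ↔ _
  rw [Fin.exists_fin_succ, Fin.exists_fin_two]
  simp only [eq_comm (a := x)]
  rfl

lemma exists_tetrahedron {x₀ x₁ x₂ x₃ : Fin (N + 1)} (h₀ : x₀ < x₁) (h₁ : x₁ < x₂) (h₂ : x₂ < x₃) :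
    ∃ w : ⦋3⦌ ⟶ ⦋N⦌, Function.Injective w.toOrderHom ∧ supp w = {x₀, x₁, x₂, x₃} ∧
      w.toOrderHom 0 = x₀ ∧ w.toOrderHom 1 = x₁ ∧ w.toOrderHom 2 = x₂ ∧ w.toOrderHom 3 = x₃ := by
  have hmono : StrictMono (![x₀, x₁, x₂, x₃] : Fin 4 → Fin (N + 1)) := by
    rw [Fin.strictMono_iff_lt_succ]
    intro i
    fin_cases i
    · exact h₀
    · exact h₁
    · exact h₂
  refine ⟨SimplexCategory.Hom.mk ⟨![x₀, x₁, x₂, x₃], hmono.monotone⟩, hmono.injective, ?_,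
    rfl, rfl, rfl, rfl⟩
  ext x
  simp only [mem_supp, Finset.mem_insert, Finset.mem_singleton]
  change (∃ i : Fin 4, (![x₀, x₁, x₂, x₃] : Fin 4 → Fin (N + 1)) i = x) ↔ _
  rw [Fin.exists_fin_succ, Fin.exists_fin_succ, Fin.exists_fin_two]
  simp [eq_comm]

variable [ScaledSSet.IsInftyBicategory C] {M : PartialSimplex C.toSSet N P}
  (hP : ∀ ⦃S S'⦄, S ⊆ S' → P S' → P S) {x₀ x₁ x₂ x₃ : Fin (N + 1)}
  (h₀ : x₀ < x₁) (h₁ : x₁ < x₂) (h₂ : x₂ < x₃) (h : P {x₀, x₁, x₂, x₃})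

include hP h₀ h₁ h₂ h

/-- Transfer of `ScaledSSet.isThinTriangle_zero_two_three` to a `3`-simplex in the domain. -/
lemma isThinAt_zero_two_three (h012 : M.IsThinAt x₀ x₁ x₂) (h013 : M.IsThinAt x₀ x₁ x₃)
    (h123 : M.IsThinAt x₁ x₂ x₃) : M.IsThinAt x₀ x₂ x₃ := by
  obtain ⟨w, hinj, hw, rfl, rfl, rfl, rfl⟩ := exists_tetrahedron h₀ h₁ h₂
  rw [← hw] at h
  exact isThinAt_of_isThinTriangle hinj (ScaledSSet.isThinTriangle_zero_two_three
    (h012.isThinTriangle hP w h) (h013.isThinTriangle hP w h) (h123.isThinTriangle hP w h))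

/-- Transfer of `ScaledSSet.isThinTriangle_zero_one_three` to a `3`-simplex in the domain. -/
lemma isThinAt_zero_one_three (h012 : M.IsThinAt x₀ x₁ x₂) (h023 : M.IsThinAt x₀ x₂ x₃)
    (h123 : M.IsThinAt x₁ x₂ x₃) : M.IsThinAt x₀ x₁ x₃ := by
  obtain ⟨w, hinj, hw, rfl, rfl, rfl, rfl⟩ := exists_tetrahedron h₀ h₁ h₂
  rw [← hw] at h
  exact isThinAt_of_isThinTriangle hinj (ScaledSSet.isThinTriangle_zero_one_three
    (h012.isThinTriangle hP w h) (h023.isThinTriangle hP w h) (h123.isThinTriangle hP w h))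

end PartialSimplex

/-! ### Extension along toggled vertices -/

/-- The vertex `v` of the simplex with set of vertices `S` can serve as the pivot of an inner horn
filling which respects the scaling `T`. -/
structure IsPivot {N : ℕ} (T : ℕ → ℕ → ℕ → Prop) (S : Finset (Fin (N + 1))) (v : Fin (N + 1)) :
    Prop where
  /-- the triangle spanned by `v` and its two neighbours in `S` is thin -/
  exists_neighbours : ∃ a ∈ S, ∃ c ∈ S, a < v ∧ v < c ∧ (∀ x ∈ S, x ≤ a ∨ x = v ∨ c ≤ x) ∧ T a v c
  /-- if the face opposite to `v` is a triangle which has to be thin, then all the other triangles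
  are thin -/
  thin_faces : ∀ ⦃x y z : Fin (N + 1)⦄, S = {x, y, z, v} → x < y → y < z → T x y z →
    (x < v → v < y → T x v y ∧ T x v z ∧ T v y z) ∧ (y < v → v < z → T x y v ∧ T x v z ∧ T y v z)

namespace PartialSimplex

variable {N : ℕ} {P : Finset (Fin (N + 1)) → Prop} {C : ScaledSSet.{u}}
  [ScaledSSet.IsInftyBicategory C] {T : ℕ → ℕ → ℕ → Prop}

/-- If all triangles of a simplex which contain its pivot `v` respect the scaling, then so does the
face opposite to `v`, in case it is a triangle. -/
lemma isThinAt_of_isPivot (hP : ∀ ⦃S S'⦄, S ⊆ S' → P S' → P S) {S : Finset (Fin (N + 1))}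
    (hS : P S) {v : Fin (N + 1)} (hpivot : IsPivot T S v) {M : PartialSimplex C.toSSet N P}
    (hM : ∀ ⦃p q r⦄, p < q → q < r → {p, q, r} ⊆ S → v ∈ ({p, q, r} : Finset _) →
      T p q r → M.IsThinAt p q r)
    {x y z : Fin (N + 1)} (hS' : S = {x, y, z, v}) (hxy : x < y) (hyz : y < z) (hvy : v ≠ y)
    (hT : T x y z) : M.IsThinAt x y z := by
  obtain ⟨hc1, hc2⟩ := hpivot.thin_faces hS' hxy hyz hT
  obtain ⟨a, ha, c, hc, hav, hvc, -, -⟩ := hpivot.exists_neighbours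
  subst hS'
  simp only [Finset.mem_insert, Finset.mem_singleton] at ha hc
  have hxv : x < v := by
    obtain rfl | rfl | rfl | rfl := ha
    exacts [hav, hxy.trans hav, (hxy.trans hyz).trans hav, absurd hav (lt_irrefl _)]
  have hvz : v < z := by
    obtain rfl | rfl | rfl | rfl := hc
    exacts [hvc.trans (hxy.trans hyz), hvc.trans hyz, hvc, absurd hvc (lt_irrefl _)]
  simp only [Finset.insert_subset_iff, Finset.singleton_subset_iff, Finset.mem_insert,
    Finset.mem_singleton] at hM
  obtain hvy | hyv := lt_or_gt_of_ne hvy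
  · obtain ⟨t1, t2, t3⟩ := hc1 hxv hvy
    refine isThinAt_zero_two_three hP hxv hvy hyz (hP ?_ hS)
      (hM hxv hvy (by simp) (by simp) t1) (hM hxv hvz (by simp) (by simp) t2)
      (hM hvy hyz (by simp) (by simp) t3)
    simp [Finset.insert_subset_iff]
  · obtain ⟨t1, t2, t3⟩ := hc2 hyv hvz
    refine isThinAt_zero_one_three hP hxy hyv hvz (hP ?_ hS)
      (hM hxy hyv (by simp) (by simp) t1) (hM hxv hvz (by simp) (by simp) t2)
      (hM hyv hvz (by simp) (by simp) t3)
    simp [Finset.insert_subset_iff]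

/-- A map can be extended to a simplex `S` whose intersection with the domain is the horn at a
pivot `v` of `S`. -/
lemma exists_extends_simplex (hP : ∀ ⦃S S'⦄, S ⊆ S' → P S' → P S)
    {S : Finset (Fin (N + 1))} {v : Fin (N + 1)} (hv : v ∈ S) (hSv : ¬ P (S.erase v))
    (hface : ∀ w ∈ S, w ≠ v → P (S.erase w)) (hpivot : IsPivot T S v)
    (M : PartialSimplex C.toSSet N P) (hM : M.RespectsScaling T) :
    ∃ M' : PartialSimplex C.toSSet N (fun R ↦ P R ∨ R ⊆ S),
      M'.Extends M ∧ M'.RespectsScaling T := by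
  obtain ⟨a, ha, c, hc, hav, hvc, hcons, hT⟩ := hpivot.exists_neighbours
  obtain ⟨m, hm⟩ : ∃ m, S.card = m + 1 := ⟨S.card - 1, by
    have := Finset.card_pos.2 ⟨v, hv⟩
    omega⟩
  obtain ⟨e, he, rfl⟩ := exists_supp_eq (l := ⦋N⦌) S hm
  have hmono : StrictMono e.toOrderHom := e.toOrderHom.monotone.strictMono_of_injective he
  obtain ⟨k, rfl⟩ := mem_supp.1 hv
  obtain ⟨ka, rfl⟩ := mem_supp.1 ha
  obtain ⟨kc, rfl⟩ := mem_supp.1 hc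
  -- the neighbours of `v = e k` are `e (k - 1)` and `e (k + 1)`
  have hcons' (i : Fin (m + 1)) : i ≤ ka ∨ i = k ∨ kc ≤ i := by
    have := hcons _ (apply_mem_supp e i)
    rwa [hmono.le_iff_le, hmono.le_iff_le, he.eq_iff] at this
  have hka : (ka : ℕ) = k - 1 := by
    have h1 : ka < k := hmono.lt_iff_lt.1 hav
    have h2 : k < kc := hmono.lt_iff_lt.1 hvc
    have hk : (k : ℕ) < m + 1 := k.is_lt
    have h3 := hcons' ⟨k - 1, by omega⟩
    simp only [Fin.le_def, Fin.lt_def, Fin.ext_iff] at h1 h2 h3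
    omega
  have hkc : (kc : ℕ) = k + 1 := by
    have h1 : ka < k := hmono.lt_iff_lt.1 hav
    have h2 : k < kc := hmono.lt_iff_lt.1 hvc
    have hk : (kc : ℕ) < m + 1 := kc.is_lt
    have h3 := hcons' ⟨k + 1, lt_of_le_of_lt h2 hk⟩
    simp only [Fin.le_def, Fin.lt_def, Fin.ext_iff] at h1 h2 h3
    omega
  have hk0 : 0 < k := lt_of_le_of_lt (Fin.zero_le _) (hmono.lt_iff_lt.1 hav)
  have hkm : k < Fin.last m := lt_of_lt_of_le (hmono.lt_iff_lt.1 hvc) (Fin.le_last _)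
  have hhorn ⦃l : SimplexCategory⦄ (t : l ⟶ ⦋m⦌) (ht : ∃ j, j ≠ k ∧ j ∉ supp t) :
      P (supp (t ≫ e)) := by
    obtain ⟨j, hj, hjt⟩ := ht
    refine hP ?_ (hface (e.toOrderHom j) (apply_mem_supp e j) (he.ne hj))
    intro x hx
    obtain ⟨i, rfl⟩ := mem_supp.1 hx
    refine Finset.mem_erase.2 ⟨fun h ↦ hjt ?_, apply_mem_supp e (t.toOrderHom i)⟩
    exact mem_supp.2 ⟨i, he h⟩
  obtain ⟨y, hy, hythin⟩ := C.exists_inner_filler k hk0 hkm (M.pullback e hhorn) (by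
    intro s hs h0 h1 h2
    exact hM hav hvc hT (s ≫ e) (hhorn s hs)
      (congrArg (fun x ↦ (e.toOrderHom x : ℕ)) (Fin.ext (h0.trans hka.symm)))
      (congrArg (fun x ↦ (e.toOrderHom x : ℕ)) (Fin.ext h1))
      (congrArg (fun x ↦ (e.toOrderHom x : ℕ)) (Fin.ext (h2.trans hkc.symm))))
  -- a simplex of `S` in the domain lies in the horn, as the face opposite to `v` is missing
  have hagree ⦃l : SimplexCategory⦄ (t : l ⟶ ⦋m⦌) (ht : P (supp (t ≫ e))) :
      C.toSSet.map t.op y = M.val (t ≫ e) ht := by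
    refine hy t ?_
    by_contra! hcontra
    refine hSv (hP ?_ ht)
    intro x hx
    obtain ⟨hx1, hx2⟩ := Finset.mem_erase.1 hx
    obtain ⟨j, rfl⟩ := mem_supp.1 hx2
    obtain ⟨i, rfl⟩ := mem_supp.1 (hcontra j fun h ↦ hx1 (h ▸ rfl))
    exact mem_supp.2 ⟨i, rfl⟩
  let R : ∀ ⦃l : SimplexCategory⦄, (l ⟶ ⦋N⦌) → C.toSSet.obj (op l) → Prop := fun l s z ↦
    (∃ hs, z = M.val s hs) ∨ ∃ t, t ≫ e = s ∧ z = C.toSSet.map t.op y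
  have huniq ⦃l : SimplexCategory⦄ (s : l ⟶ ⦋N⦌) (z z') (hz : R s z) (hz' : R s z') : z = z' := by
    obtain ⟨hs, rfl⟩ | ⟨t, rfl, rfl⟩ := hz <;> obtain ⟨hs', rfl⟩ | ⟨t', ht', rfl⟩ := hz'
    · rfl
    · subst ht'
      exact (hagree t' hs).symm
    · exact hagree t hs'
    · rw [comp_left_injective he ht']
  let M' : PartialSimplex C.toSSet N (fun R ↦ P R ∨ R ⊆ supp e) := ofRel R
    (fun l s hs ↦ by
      obtain hs | hs := hs
      · exact ⟨_, Or.inl ⟨hs, rfl⟩⟩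
      · obtain ⟨t, ht⟩ := exists_comp_eq he s hs
        exact ⟨_, Or.inr ⟨t, ht, rfl⟩⟩)
    huniq
    (fun k l g s z hz ↦ by
      obtain ⟨hs, rfl⟩ | ⟨t, rfl, rfl⟩ := hz
      · exact Or.inl ⟨hP (supp_comp_subset g s) hs, M.map_val g s hs _⟩
      · refine Or.inr ⟨g ≫ t, Category.assoc _ _ _, ?_⟩
        rw [← Functor.map_comp_apply, ← op_comp])
  have hext : M'.Extends M := fun l s hs hs' ↦
    huniq s _ _ (rel_val (huniq := huniq) s hs') (Or.inl ⟨hs, rfl⟩)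
  have hP' ⦃S S'⦄ (h : S ⊆ S') (hS' : P S' ∨ S' ⊆ supp e) : P S ∨ S ⊆ supp e :=
    hS'.imp (hP h) h.trans
  have hthin ⦃x y z : ℕ⦄ (hxy : x < y) (hyz : y < z) (h : T x y z)
      (hmem : ∀ s : ⦋2⦌ ⟶ ⦋N⦌, (s.toOrderHom 0 : ℕ) = x → (s.toOrderHom 1 : ℕ) = y →
        (s.toOrderHom 2 : ℕ) = z → P (supp s)) : M'.IsThinAt x y z := by
    intro s hs h0 h1 h2
    rw [hext s (hmem s h0 h1 h2) hs]
    exact hM hxy hyz h s _ h0 h1 h2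
  refine ⟨M', hext, ?_⟩
  intro x₀ y₀ z₀ hxy hyz hT' s hs h0 h1 h2
  by_cases hPs : P (supp s)
  · rw [hext s hPs hs]
    exact hM hxy hyz hT' s _ h0 h1 h2
  have hse : supp s ⊆ supp e := hs.resolve_left hPs
  obtain ⟨x, hx⟩ : ∃ x, x = s.toOrderHom 0 := ⟨_, rfl⟩
  obtain ⟨y', hy'⟩ : ∃ y', y' = s.toOrderHom 1 := ⟨_, rfl⟩
  obtain ⟨z, hz⟩ : ∃ z, z = s.toOrderHom 2 := ⟨_, rfl⟩
  have hsupp : supp s = {x, y', z} := by rw [supp_eq_triple, hx, hy', hz]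
  rw [← hx] at h0
  rw [← hy'] at h1
  rw [← hz] at h2
  subst h0 h1 h2
  replace hxy : x < y' := hxy
  replace hyz : y' < z := hyz
  -- as `s` is not in the domain, it is `S` or the face of `S` opposite to `v`
  have hmem (w) (hw : w ∈ supp e) (hwv : w ≠ e.toOrderHom k) : w ∈ supp s := by
    by_contra h
    refine hPs (hP ?_ (hface w hw hwv))
    exact fun u hu ↦ Finset.mem_erase.2 ⟨fun h' ↦ h (h' ▸ hu), hse hu⟩
  by_cases hvs : e.toOrderHom k ∈ supp s
  -- the simplex `S` itself is a triangle, whose thinness is part of the horn filling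
  · have has := hmem _ ha hav.ne
    have hcs := hmem _ hc hvc.ne'
    rw [hsupp] at hvs has hcs
    simp only [Finset.mem_insert, Finset.mem_singleton] at hvs has hcs
    have e1 : e.toOrderHom ka = x ∧ e.toOrderHom k = y' ∧ e.toOrderHom kc = z := by
      have hxz := hxy.trans hyz
      obtain h | h | h := hvs
      · rw [h] at hav
        obtain h' | h' | h' := has <;> rw [h'] at hav
        exacts [absurd hav (lt_irrefl _), absurd hav hxy.not_gt, absurd hav hxz.not_gt]
      · rw [h] at hav hvc
        refine ⟨?_, h, ?_⟩
        · obtain h' | h' | h' := has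
          · exact h'
          · exact absurd (h' ▸ hav) (lt_irrefl _)
          · exact absurd (h' ▸ hav) hyz.not_gt
        · obtain h' | h' | h' := hcs
          · exact absurd (h' ▸ hvc) hxy.not_gt
          · exact absurd (h' ▸ hvc) (lt_irrefl _)
          · exact h'
      · rw [h] at hvc
        obtain h' | h' | h' := hcs <;> rw [h'] at hvc
        exacts [absurd hvc hxz.not_gt, absurd hvc hyz.not_gt, absurd hvc (lt_irrefl _)]
    obtain ⟨t, ht⟩ := exists_comp_eq he s hse
    rw [huniq s _ _ (rel_val (huniq := huniq) s hs) (Or.inr ⟨t, ht, rfl⟩)]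
    subst ht
    refine hythin t ?_ ?_ ?_
    · rw [← hka]
      exact congrArg Fin.val (he (hx.symm.trans e1.1.symm))
    · exact congrArg Fin.val (he (hy'.symm.trans e1.2.1.symm))
    · rw [← hkc]
      exact congrArg Fin.val (he (hz.symm.trans e1.2.2.symm))
  · have hS : supp e = {x, y', z, e.toOrderHom k} := by
      ext u
      have : u ∈ supp e ↔ u ∈ supp s ∨ u = e.toOrderHom k :=
        ⟨fun hu ↦ or_iff_not_imp_right.2 (hmem u hu), fun hu ↦ hu.elim (@hse u) (fun h ↦ h ▸ hv)⟩
      rw [this, hsupp]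
      simp only [Finset.mem_insert, Finset.mem_singleton, or_assoc]
    rw [hsupp] at hvs
    simp only [Finset.mem_insert, Finset.mem_singleton, not_or] at hvs
    have hcard : (supp e).card = 4 := by
      rw [hS]
      simp [hxy.ne, (hxy.trans hyz).ne, hyz.ne, Ne.symm hvs.1, Ne.symm hvs.2.1, Ne.symm hvs.2.2]
    refine isThinAt_of_isPivot hP' (Or.inr subset_rfl) hpivot (M := M') (fun p q r hpq hqr hs hv hT ↦
      hthin hpq hqr hT fun t h0 h1 h2 ↦ ?_) hS hxy hyz hvs.2.1 hT' s hs
      (congrArg Fin.val hx.symm) (congrArg Fin.val hy'.symm) (congrArg Fin.val hz.symm)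
    rw [supp_eq_triple, show t.toOrderHom 0 = p from Fin.ext h0,
      show t.toOrderHom 1 = q from Fin.ext h1, show t.toOrderHom 2 = r from Fin.ext h2]
    obtain ⟨w, hw, hw'⟩ : ∃ w ∈ supp e, w ∉ ({p, q, r} : Finset _) := by
      by_contra! h
      have := Finset.card_le_card (show supp e ⊆ {p, q, r} from h)
      have := Finset.card_le_three (a := p) (b := q) (c := r)
      omega
    exact hP (Finset.subset_erase.2 ⟨hs, hw'⟩) (hface w hw fun h ↦ hw' (h ▸ hv))

/-- A map can be extended from `P` to `Q` if adding and removing the vertex `v` preserves the set of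
those simplices in `Q` which are not in `P`, and `v` is a pivot of those which contain it: one fills
in the latter in the order of their dimension, together with their faces opposite to `v`. -/
lemma exists_extends_of_toggle {Q : Finset (Fin (N + 1)) → Prop}
    (hQ : ∀ ⦃S S'⦄, S ⊆ S' → Q S' → Q S) (v : Fin (N + 1)) (hP : ∀ ⦃S S'⦄, S ⊆ S' → P S' → P S)
    (hPQ : ∀ S, P S → Q S)
    (hinsert : ∀ S, Q S → ¬ P S → Q (insert v S)) (herase : ∀ S, Q S → ¬ P S → ¬ P (S.erase v))
    (hpivot : ∀ S, Q S → ¬ P S → v ∈ S → IsPivot T S v)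
    (M : PartialSimplex C.toSSet N P) (hM : M.RespectsScaling T) :
    ∃ M' : PartialSimplex C.toSSet N Q, M'.Extends M ∧ M'.RespectsScaling T := by
  classical
  induction hcard : (Finset.univ.filter fun S ↦ Q S ∧ ¬ P S).card using Nat.strong_induction_on
    generalizing P with
  | _ d ih =>
    by_cases hle : ∀ S, Q S → P S
    · exact ⟨⟨fun s hs ↦ M.val s (hle _ hs), fun g s hs _ ↦ M.map_val g s (hle _ hs) _⟩,
        fun l s hs hs' ↦ rfl, fun a b c hab hbc h s hs ↦ hM hab hbc h s (hle _ hs)⟩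
    push Not at hle
    obtain ⟨S₀, hS₀, hS₀'⟩ := hle
    -- among the missing simplices which contain `v`, fill in one of minimal dimension
    let F := Finset.univ.filter fun S ↦ (Q S ∧ ¬ P S) ∧ v ∈ S
    have hF : F.Nonempty := ⟨insert v S₀, by
      simpa [F] using ⟨hinsert S₀ hS₀ hS₀', fun h ↦ hS₀' (hP (Finset.subset_insert _ _) h)⟩⟩
    obtain ⟨S, hS, hmin⟩ := F.exists_min_image Finset.card hF
    simp only [F, Finset.mem_filter, Finset.mem_univ, true_and] at hS hmin
    obtain ⟨⟨hQS, hPS⟩, hvS⟩ := hS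
    obtain ⟨M₁, hM₁, hM₁T⟩ := exists_extends_simplex hP hvS (herase S hQS hPS) (fun w hw hwv ↦ by
      by_contra h
      have := hmin (S.erase w) ⟨⟨hQ (Finset.erase_subset _ _) hQS, h⟩,
        Finset.mem_erase.2 ⟨hwv.symm, hvS⟩⟩
      have := Finset.card_erase_lt_of_mem hw
      omega) (hpivot S hQS hPS hvS) M hM
    obtain ⟨M₂, hM₂, hM₂T⟩ := ih _ (by
        rw [← hcard]
        refine Finset.card_lt_card (Finset.ssubset_iff_of_subset ?_ |>.2 ⟨S, ?_, ?_⟩)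
        · intro R
          simp only [Finset.mem_filter, Finset.mem_univ, true_and]
          tauto
        · simp [hQS, hPS]
        · simp)
      (P := fun R ↦ P R ∨ R ⊆ S)
      (fun R R' h hR' ↦ hR'.imp (hP h) h.trans)
      (fun R hR ↦ hR.elim (hPQ R) fun h ↦ hQ h hQS)
      (fun R hR hR' ↦ hinsert R hR fun h ↦ hR' (Or.inl h))
      (fun R hR hR' h ↦ by
        obtain h | h := h
        · exact herase R hR (fun h ↦ hR' (Or.inl h)) h
        · refine hR' (Or.inr fun x hx ↦ ?_)
          by_cases hxv : x = v
          · exact hxv ▸ hvS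
          · exact h (Finset.mem_erase.2 ⟨hxv, hx⟩))
      (fun R hR hR' ↦ hpivot R hR fun h ↦ hR' (Or.inl h))
      M₁ hM₁T rfl
    exact ⟨M₂, hM₂.trans hM₁ fun R hR ↦ Or.inl hR, hM₂T⟩

end PartialSimplex

/-! ### Extending maps from a horn of `Q(n)` -/

/-- The simplices of `Δ^n ⋆ (Δ^n)ᵒᵖ` which lie in `Δ^n`, in `(Δ^n)ᵒᵖ`, or in `Δ^σ ⋆ (Δ^σ)ᵒᵖ` for a
simplex `σ` of the horn `Λ^n_i`, described through their sets of vertices. -/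
def IsHornSimplex (n i : ℕ) (S : Finset (Fin (2 * n + 1 + 1))) : Prop :=
  (∀ x ∈ S, (x : ℕ) ≤ n) ∨ (∀ x ∈ S, n < (x : ℕ)) ∨
    ∃ j ≤ n, j ≠ i ∧ ∀ x ∈ S, (x : ℕ) ≠ j ∧ (x : ℕ) ≠ 2 * n + 1 - j

/-- The nondegenerate thin triangles of `Q(n)`; if `i = n`, also those which become thin or
degenerate in `Q(n-1)` under the map which identifies `n - 1` with `n`. -/
def twScaling (n i a b c : ℕ) : Prop :=
  c ≤ n ∨ n < a ∨
    (b ≤ n ∧ n < c ∧ (b + c ≤ 2 * n + 1 ∨ (i = n ∧ b = n ∧ (c ≤ n + 2 ∨ a + 1 = n)))) ∨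
    (a ≤ n ∧ n < b ∧ (2 * n + 1 ≤ a + b ∨ (i = n ∧ b = n + 1 ∧ (n ≤ a + 1 ∨ c = n + 2))))

lemma IsHornSimplex.mono {n i : ℕ} {S S' : Finset (Fin (2 * n + 1 + 1))} (h : S ⊆ S') :
    IsHornSimplex n i S' → IsHornSimplex n i S := by
  rintro (hS | hS | ⟨j, hj, hji, hS⟩)
  · exact Or.inl fun x hx ↦ hS x (h hx)
  · exact Or.inr (Or.inl fun x hx ↦ hS x (h hx))
  · exact Or.inr (Or.inr ⟨j, hj, hji, fun x hx ↦ hS x (h hx)⟩)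

lemma not_isHornSimplex_iff {n i : ℕ} {S : Finset (Fin (2 * n + 1 + 1))} :
    ¬ IsHornSimplex n i S ↔ (∃ x ∈ S, n < (x : ℕ)) ∧ (∃ x ∈ S, (x : ℕ) ≤ n) ∧
      ∀ j ≤ n, j ≠ i → ∃ x ∈ S, (x : ℕ) = j ∨ (x : ℕ) = 2 * n + 1 - j := by
  simp only [IsHornSimplex, not_forall, not_exists, not_and, not_le, not_lt, exists_prop, ne_eq,
    Decidable.not_not, Decidable.or_iff_not_imp_left]

section Pivots

variable {n i : ℕ} {S : Finset (Fin (2 * n + 1 + 1))}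

lemma twScaling_faces_rev {x y z v : ℕ} (h0 : 0 < i) (hi : i ≤ n) (hxy : x < y) (hyz : y < z)
    (hv : v = 2 * n + 1 - i)
    (hp : x = 2 * n + 2 - i ∨ y = 2 * n + 2 - i ∨ z = 2 * n + 2 - i) (hxn : x ≤ n)
    (hn : i < n → x = n ∨ y = n ∨ z = n ∨ x = n + 1 ∨ y = n + 1 ∨ z = n + 1)
    (hT : twScaling n i x y z) :
    (x < v → v < y → twScaling n i x v y ∧ twScaling n i x v z ∧ twScaling n i v y z) ∧
      (y < v → v < z → twScaling n i x y v ∧ twScaling n i x v z ∧ twScaling n i y v z) := by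
  unfold twScaling at *
  refine ⟨fun h1 h2 ↦ ⟨?_, ?_, ?_⟩, fun h1 h2 ↦ ⟨?_, ?_, ?_⟩⟩ <;> omega

lemma twScaling_faces {x y z : ℕ} (h0 : 0 < i) (hi : i ≤ n) (hxy : x < y) (hyz : y < z)
    (hp : x = i - 1 ∨ y = i - 1 ∨ z = i - 1) (hzn : n < z)
    (hn : i < n → x = n ∨ y = n ∨ z = n ∨ x = n + 1 ∨ y = n + 1 ∨ z = n + 1)
    (hT : twScaling n i x y z) :
    (x < i → i < y → twScaling n i x i y ∧ twScaling n i x i z ∧ twScaling n i i y z) ∧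
      (y < i → i < z → twScaling n i x y i ∧ twScaling n i x i z ∧ twScaling n i y i z) := by
  unfold twScaling at *
  refine ⟨fun h1 h2 ↦ ⟨?_, ?_, ?_⟩, fun h1 h2 ↦ ⟨?_, ?_, ?_⟩⟩ <;> omega

/-- If `i - 1` is not a vertex of a simplex outside the horn, then the vertex `i` of `(Δ^n)ᵒᵖ`
is a pivot: its next neighbour is the vertex `i - 1` of `(Δ^n)ᵒᵖ`. -/
lemma isPivot_rev (h0 : 0 < i) (hi : i ≤ n) (hS : ¬ IsHornSimplex n i S)
    (hp : ∀ x ∈ S, (x : ℕ) ≠ i - 1) {v : Fin (2 * n + 1 + 1)} (hv : (v : ℕ) = 2 * n + 1 - i)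
    (hvS : v ∈ S) : IsPivot (twScaling n i) S v := by
  obtain ⟨-, ⟨b, hb, hbn⟩, hj⟩ := not_isHornSimplex_iff.1 hS
  obtain ⟨c, hc, hc'⟩ : ∃ c ∈ S, (c : ℕ) = 2 * n + 2 - i := by
    obtain ⟨c, hc, h⟩ := hj (i - 1) (by omega) (by omega)
    have := hp c hc
    exact ⟨c, hc, by omega⟩
  have hn (h : i < n) : ∃ x ∈ S, (x : ℕ) = n ∨ (x : ℕ) = n + 1 := by
    obtain ⟨x, hx, h⟩ := hj n le_rfl (by omega)
    exact ⟨x, hx, by omega⟩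
  constructor
  · have hne : (S.filter (· < v)).Nonempty := ⟨b, by
      simp only [Finset.mem_filter, hb, true_and, Fin.lt_def]; omega⟩
    obtain ⟨a, ha, hmax⟩ := (S.filter (· < v)).exists_max_image id hne
    simp only [Finset.mem_filter, id, Fin.lt_def, Fin.le_def] at ha hmax
    refine ⟨a, ha.1, c, hc, ha.2, by rw [Fin.lt_def]; omega, fun x hx ↦ ?_, ?_⟩
    · rw [Fin.le_def, Fin.le_def, Fin.ext_iff]
      have := hmax x
      simp only [hx, true_and] at this
      omega
    · have h1 := hmax b ⟨hb, by omega⟩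
      unfold twScaling
      obtain rfl | hin := hi.eq_or_lt
      · clear hn
        omega
      · obtain ⟨x, hx, hx'⟩ := hn hin
        clear hn
        have h2 := hmax x ⟨hx, by omega⟩
        omega
  · rintro x y z rfl hxy hyz hT
    simp only [Finset.mem_insert, Finset.mem_singleton, exists_eq_or_imp, exists_eq_left,
      forall_eq_or_imp, forall_eq] at hn hp hc hb
    rw [Fin.lt_def] at hxy hyz
    simp only [Fin.lt_def]
    refine twScaling_faces_rev h0 hi hxy hyz hv ?_ ?_ (fun h ↦ ?_) hT
    · obtain rfl | rfl | rfl | rfl := hc <;> omega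
    · obtain rfl | rfl | rfl | rfl := hb <;> omega
    · have := hn h
      omega

/-- If `i - 1` is a vertex of a simplex outside the horn, then the vertex `i` is a pivot. -/
lemma isPivot (h0 : 0 < i) (hi : i ≤ n) (hS : ¬ IsHornSimplex n i S) {v a : Fin (2 * n + 1 + 1)}
    (ha : (a : ℕ) = i - 1) (haS : a ∈ S) (hv : (v : ℕ) = i) (hvS : v ∈ S) :
    IsPivot (twScaling n i) S v := by
  obtain ⟨⟨b, hb, hbn⟩, -, hj⟩ := not_isHornSimplex_iff.1 hS
  have hn (h : i < n) : ∃ x ∈ S, (x : ℕ) = n ∨ (x : ℕ) = n + 1 := by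
    obtain ⟨x, hx, h⟩ := hj n le_rfl (by omega)
    exact ⟨x, hx, by omega⟩
  constructor
  · have hne : (S.filter (v < ·)).Nonempty := ⟨b, by
      simp only [Finset.mem_filter, hb, true_and, Fin.lt_def]; omega⟩
    obtain ⟨c, hc, hmin⟩ := (S.filter (v < ·)).exists_min_image id hne
    simp only [Finset.mem_filter, id, Fin.lt_def, Fin.le_def] at hc hmin
    refine ⟨a, haS, c, hc.1, by rw [Fin.lt_def]; omega, hc.2, fun x hx ↦ ?_, ?_⟩
    · rw [Fin.le_def, Fin.le_def, Fin.ext_iff]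
      have := hmin x
      simp only [hx, true_and] at this
      omega
    · have h1 := hmin b ⟨hb, by omega⟩
      unfold twScaling
      obtain rfl | hin := hi.eq_or_lt
      · clear hn
        omega
      · obtain ⟨x, hx, hx'⟩ := hn hin
        clear hn
        have h2 := hmin x ⟨hx, by omega⟩
        omega
  · rintro x y z rfl hxy hyz hT
    simp only [Finset.mem_insert, Finset.mem_singleton, exists_eq_or_imp, exists_eq_left]
      at hn haS hb
    rw [Fin.lt_def] at hxy hyz
    simp only [Fin.lt_def, hv]
    refine twScaling_faces h0 hi hxy hyz ?_ ?_ (fun h ↦ ?_) hT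
    · obtain rfl | rfl | rfl | rfl := haS <;> omega
    · obtain rfl | rfl | rfl | rfl := hb <;> omega
    · have := hn h
      omega

end Pivots

/-- Maps defined on a horn of `Q(n)` extend to `Q(n)`. First one adds the simplices without the
vertex `i - 1`, in which the vertex `i` of `(Δ^n)ᵒᵖ` is toggled, and then the others, in which the
vertex `i` of `Δ^n` is toggled. -/
theorem PartialSimplex.exists_extends_of_isHornSimplex {C : ScaledSSet.{u}}
    [ScaledSSet.IsInftyBicategory C] {n i : ℕ} (h0 : 0 < i) (hi : i ≤ n)
    (M : PartialSimplex C.toSSet (2 * n + 1) (IsHornSimplex n i))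
    (hM : M.RespectsScaling (twScaling n i)) :
    ∃ M' : PartialSimplex C.toSSet (2 * n + 1) (fun _ ↦ True),
      M'.Extends M ∧ M'.RespectsScaling (twScaling n i) := by
  let P₁ : Finset (Fin (2 * n + 1 + 1)) → Prop := fun S ↦
    IsHornSimplex n i S ∨ ∀ x ∈ S, (x : ℕ) ≠ i - 1
  have hP₁ ⦃S S' : Finset (Fin (2 * n + 1 + 1))⦄ (h : S ⊆ S') (hS : P₁ S') : P₁ S :=
    hS.imp (IsHornSimplex.mono h) fun hS x hx ↦ hS x (h hx)
  obtain ⟨M₁, hM₁, hM₁T⟩ := exists_extends_of_toggle hP₁ ⟨2 * n + 1 - i, by omega⟩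
    (fun _ _ h ↦ IsHornSimplex.mono h) (fun S hS ↦ Or.inl hS)
    (fun S hS hS' ↦ Or.inr fun x hx ↦ by
      obtain rfl | hx := Finset.mem_insert.1 hx
      · dsimp only
        omega
      · exact hS.resolve_left hS' x hx)
    (fun S hS hS' ↦ by
      obtain ⟨-, ⟨b, hb, hbn⟩, hj⟩ := not_isHornSimplex_iff.1 hS'
      refine not_isHornSimplex_iff.2 ⟨?_, ?_, fun j hjn hji ↦ ?_⟩
      · obtain ⟨x, hx, h⟩ := hj (i - 1) (by omega) (by omega)
        have := hS.resolve_left hS' x hx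
        refine ⟨x, Finset.mem_erase.2 ⟨fun h' ↦ ?_, hx⟩, by omega⟩
        rw [Fin.ext_iff] at h'
        dsimp only at h'
        omega
      · refine ⟨b, Finset.mem_erase.2 ⟨fun h' ↦ ?_, hb⟩, hbn⟩
        rw [Fin.ext_iff] at h'
        dsimp only at h'
        omega
      · obtain ⟨x, hx, h⟩ := hj j hjn hji
        refine ⟨x, Finset.mem_erase.2 ⟨fun h' ↦ ?_, hx⟩, h⟩
        rw [Fin.ext_iff] at h'
        dsimp only at h'
        omega)
    (fun S hS hS' hv ↦ isPivot_rev h0 hi hS' (hS.resolve_left hS') rfl hv) M hM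
  obtain ⟨M₂, hM₂, hM₂T⟩ := exists_extends_of_toggle (Q := fun _ ↦ True)
    (fun _ _ _ _ ↦ trivial) ⟨i, by omega⟩ hP₁
    (fun _ _ ↦ trivial) (fun _ _ _ ↦ trivial)
    (fun S _ hS' ↦ by
      obtain ⟨hS₁, hS₂⟩ := not_or.1 hS'
      push Not at hS₂
      obtain ⟨a, ha, ha'⟩ := hS₂
      obtain ⟨⟨b, hb, hbn⟩, -, hj⟩ := not_isHornSimplex_iff.1 hS₁
      have hmem {x} (hx : x ∈ S) (hxi : (x : ℕ) ≠ i) : x ∈ S.erase ⟨i, by omega⟩ :=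
        Finset.mem_erase.2 ⟨fun h ↦ hxi (Fin.ext_iff.1 h), hx⟩
      refine not_or.2 ⟨not_isHornSimplex_iff.2 ⟨⟨b, hmem hb (by omega), hbn⟩,
        ⟨a, hmem ha (by omega), by omega⟩, fun j hjn hji ↦ ?_⟩,
        fun h ↦ h a (hmem ha (by omega)) ha'⟩
      obtain ⟨x, hx, h⟩ := hj j hjn hji
      exact ⟨x, hmem hx (by omega), h⟩)
    (fun S _ hS' hv ↦ by
      obtain ⟨hS₁, hS₂⟩ := not_or.1 hS'
      push Not at hS₂
      obtain ⟨a, ha, ha'⟩ := hS₂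
      exact isPivot h0 hi hS₁ ha' ha rfl hv) M₁ hM₁T
  exact ⟨M₂, hM₂.trans hM₁ fun _ ↦ Or.inl, hM₂T⟩

/-! ### Simplices of `Δ^n ⋆ (Δ^n)ᵒᵖ` -/

/-- The vertex `i` of `[n]` which corresponds to a vertex `i` or `i̅` of `[n] ⋆ [n]ᵒᵖ`. -/
def joinFold {n : ℕ} (x : Fin (2 * n + 1 + 1)) : Fin (n + 1) :=
  if h : (x : ℕ) < n + 1 then ⟨x, h⟩ else ⟨x.rev, by rw [Fin.val_rev]; omega⟩

lemma joinFold_spec {n : ℕ} (x : Fin (2 * n + 1 + 1)) :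
    (x : ℕ) ≤ n ∧ (joinFold x : ℕ) = x ∨ n < (x : ℕ) ∧ (joinFold x : ℕ) = 2 * n + 1 - x := by
  unfold joinFold
  split_ifs with h
  · exact Or.inl ⟨by omega, rfl⟩
  · exact Or.inr ⟨by omega, by simp⟩

/-- The values of `joinOp.map σ`, separately on the two factors of the join. -/
lemma joinOp_map_spec {m k : SimplexCategory} (σ : m ⟶ k) (x : Fin (2 * m.len + 1 + 1)) :
    ((x : ℕ) ≤ m.len ∧ (x : ℕ) = joinFold x ∧
      ((joinOp.map σ).toOrderHom x : ℕ) = σ.toOrderHom (joinFold x)) ∨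
    (m.len < (x : ℕ) ∧ (x : ℕ) = 2 * m.len + 1 - joinFold x ∧
      ((joinOp.map σ).toOrderHom x : ℕ) = 2 * k.len + 1 - σ.toOrderHom (joinFold x)) := by
  have h := joinFold_spec x
  have hx := x.is_lt
  obtain h | h := h
  · have e : x = joinVertex (joinFold x) := Fin.ext h.2.symm
    refine Or.inl ⟨h.1, h.2.symm, ?_⟩
    have := congrArg Fin.val (joinOpMap_vertex σ.toOrderHom (joinFold x))
    rw [← e] at this
    exact this
  · have e : x = (joinVertex (joinFold x)).rev := by
      ext
      simp only [joinVertex, Fin.val_rev, Fin.val_castLE]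
      omega
    refine Or.inr ⟨h.1, by omega, ?_⟩
    have := congrArg Fin.val (joinOpMap_vertex_rev σ.toOrderHom (joinFold x))
    rw [← e] at this
    refine Eq.trans this ?_
    simp only [joinVertex, Fin.val_rev, Fin.val_castLE]
    omega

lemma joinFold_joinOp_map {m k : SimplexCategory} (σ : m ⟶ k) (x : Fin (2 * m.len + 1 + 1)) :
    joinFold (n := k.len) ((joinOp.map σ).toOrderHom x) = σ.toOrderHom (joinFold x) := by
  have h1 := joinOp_map_spec σ x
  have h2 := joinFold_spec (n := k.len) ((joinOp.map σ).toOrderHom x)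
  have h3 := (σ.toOrderHom (joinFold x)).is_lt
  ext
  omega

lemma joinOp_map_injective {m k : SimplexCategory} {σ : m ⟶ k}
    (hσ : Function.Injective σ.toOrderHom) : Function.Injective (joinOp.map σ).toOrderHom := by
  intro (x : Fin (2 * m.len + 1 + 1)) (y : Fin (2 * m.len + 1 + 1)) h
  have hx := joinOp_map_spec σ x
  have hy := joinOp_map_spec σ y
  have hf : joinFold x = joinFold y := by
    apply hσ
    rw [← joinFold_joinOp_map, ← joinFold_joinOp_map, h]
  have h3 := (σ.toOrderHom (joinFold x)).is_lt
  have h4 := congrArg Fin.val h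
  rw [← hf] at hy
  ext
  omega

lemma mem_supp_joinOp_map {m k : SimplexCategory} (σ : m ⟶ k) (x : Fin ((joinOp.obj k).len + 1)) :
    x ∈ supp (joinOp.map σ) ↔ joinFold (n := k.len) x ∈ supp σ := by
  constructor
  · intro h
    obtain ⟨y, rfl⟩ := mem_supp.1 h
    exact mem_supp.2 ⟨joinFold (n := m.len) y, (joinFold_joinOp_map σ y).symm⟩
  · intro h
    obtain ⟨y, hy⟩ := mem_supp.1 h
    refine mem_supp.2 ?_
    have hx := joinFold_spec (n := k.len) x
    have hyx := congrArg Fin.val hy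
    have hxl : (x : ℕ) < 2 * k.len + 1 + 1 := x.is_lt
    obtain hx | hx := hx
    · refine ⟨joinVertex y, ?_⟩
      refine (joinOpMap_vertex σ.toOrderHom y).trans ?_
      ext
      simp only [joinVertex, Fin.val_castLE]
      omega
    · refine ⟨(joinVertex y).rev, ?_⟩
      refine (joinOpMap_vertex_rev σ.toOrderHom y).trans ?_
      ext
      simp only [joinVertex, Fin.val_rev, Fin.val_castLE]
      omega

lemma joinInl_injective (m : SimplexCategory) : Function.Injective (joinInl.app m).toOrderHom := by
  intro x y h
  exact Fin.ext (congrArg Fin.val h :)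

lemma joinInr_injective (m : SimplexCategory) : Function.Injective (joinInr.app m).toOrderHom := by
  intro x y h
  have h' : (joinVertex (Fin.rev (n := m.len + 1) x)).rev =
    (joinVertex (Fin.rev (n := m.len + 1) y)).rev := h
  rw [Fin.rev_inj] at h'
  exact Fin.rev_inj.1 (Fin.ext (congrArg Fin.val h' :))

lemma mem_supp_joinInl {m : SimplexCategory} (x : Fin ((joinOp.obj m).len + 1)) :
    x ∈ supp (joinInl.app m) ↔ (x : ℕ) ≤ m.len := by
  refine mem_supp.trans ?_
  constructor
  · rintro ⟨i, rfl⟩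
    exact Nat.le_of_lt_succ i.is_lt
  · intro h
    exact ⟨(⟨x, Nat.lt_succ_of_le h⟩ : Fin (m.len + 1)), rfl⟩

lemma mem_supp_joinInr {m : SimplexCategory} (x : Fin ((joinOp.obj m).len + 1)) :
    x ∈ supp (joinInr.app m) ↔ m.len < (x : ℕ) := by
  refine mem_supp.trans ?_
  constructor
  · rintro ⟨i, rfl⟩
    exact lt_joinVertex_rev (Fin.rev (n := m.len + 1) i)
  · intro h
    refine ⟨Fin.rev (joinFold (n := m.len) x), ?_⟩
    have h1 := joinFold_spec (n := m.len) x
    have hxl : (x : ℕ) < 2 * m.len + 1 + 1 := x.is_lt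
    change (joinVertex (Fin.rev (Fin.rev (joinFold (n := m.len) x)))).rev = x
    rw [Fin.rev_rev]
    ext
    simp only [joinVertex, Fin.val_rev, Fin.val_castLE]
    omega

/-! ### Lifting problems against the canonical map -/

/-- A lifting problem of the horn `Λ^n_i ⟶ Δ^n` against `Tw(C) ⟶ 𝒞 × 𝒞ᵒᵖ`. -/
structure TwHorn (C : ScaledSSet.{u}) (n : ℕ) (i : Fin (n + 1)) where
  /-- the map `Λ^n_i ⟶ Tw(C)` -/
  map : ∀ {m : SimplexCategory} (σ : m ⟶ ⦋n⦌), (∃ j, j ≠ i ∧ j ∉ supp σ) → (Q.obj m ⟶ C)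
  map_comp : ∀ {k m : SimplexCategory} (g : k ⟶ m) (σ : m ⟶ ⦋n⦌) h h',
    map (g ≫ σ) h' = Q.map g ≫ map σ h
  /-- the simplex of `𝒞` -/
  left : C.toSSet.obj (op ⦋n⦌)
  left_mem : left ∈ C.underlying.obj (op ⦋n⦌)
  /-- the simplex of `𝒞ᵒᵖ` -/
  right : C.toSSet.obj (op ⦋n⦌)
  right_mem : right ∈ C.underlying.obj (op ⦋n⦌)
  eval_joinInl : ∀ {m : SimplexCategory} (σ : m ⟶ ⦋n⦌) h,
    QEval (map σ h) (joinInl.app m) = C.toSSet.map σ.op left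
  eval_joinInr : ∀ {m : SimplexCategory} (σ : m ⟶ ⦋n⦌) h,
    QEval (map σ h) (joinInr.app m) = C.toSSet.map (SimplexCategory.rev.map σ).op right

namespace TwHorn

variable {C : ScaledSSet.{u}} {n : ℕ} {i : Fin (n + 1)} (H : TwHorn C n i)

/-- The lifting problem `H` sends the simplex `s` of `Δ^n ⋆ (Δ^n)ᵒᵖ` to `y`. -/
inductive Rel : ∀ {l : SimplexCategory}, (l ⟶ ⦋2 * n + 1⦌) → C.toSSet.obj (op l) → Prop
  /-- the simplices of `Δ^n` -/
  | ofLeft {l : SimplexCategory} (t : l ⟶ ⦋n⦌) :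
      Rel (t ≫ joinInl.app ⦋n⦌) (C.toSSet.map t.op H.left)
  /-- the simplices of `(Δ^n)ᵒᵖ` -/
  | ofRight {l : SimplexCategory} (t : l ⟶ SimplexCategory.rev.obj ⦋n⦌) :
      Rel (t ≫ joinInr.app ⦋n⦌) (C.toSSet.map t.op H.right)
  /-- the simplices of `Δ^σ ⋆ (Δ^σ)ᵒᵖ`, for a nondegenerate simplex `σ` of the horn -/
  | ofMap {l m : SimplexCategory} (σ : m ⟶ ⦋n⦌) (hσ : Function.Injective σ.toOrderHom)
      (h : ∃ j, j ≠ i ∧ j ∉ supp σ) (t : l ⟶ joinOp.obj m) :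
      Rel (t ≫ joinOp.map σ) (QEval (H.map σ h) t)

lemma Rel.comp {k l : SimplexCategory} (g : k ⟶ l) {s : l ⟶ ⦋2 * n + 1⦌} {y} (h : H.Rel s y) :
    H.Rel (g ≫ s) (C.toSSet.map g.op y) := by
  cases h with
  | ofLeft t =>
    rw [← Functor.map_comp_apply, ← op_comp]
    exact Rel.ofLeft (g ≫ t)
  | ofRight t =>
    rw [← Functor.map_comp_apply, ← op_comp]
    exact Rel.ofRight (g ≫ t)
  | ofMap σ hσ h t =>
    rw [map_QEval]
    exact Rel.ofMap σ hσ h (g ≫ t)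

/-- On simplices of `Δ^n`, the prescribed values agree. -/
lemma Rel.eq_left {l : SimplexCategory} {s : l ⟶ ⦋2 * n + 1⦌} {y} (h : H.Rel s y)
    (t : l ⟶ ⦋n⦌) (ht : t ≫ joinInl.app ⦋n⦌ = s) : y = C.toSSet.map t.op H.left := by
  have hle (a : Fin (l.len + 1)) : (s.toOrderHom a : ℕ) ≤ n := by
    rw [← ht]
    exact (mem_supp_joinInl (m := ⦋n⦌) _).1 (supp_comp_subset _ _ (apply_mem_supp _ a))
  cases h with
  | ofLeft t' => rw [comp_left_injective (joinInl_injective _) ht]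
  | ofRight t' =>
    have h1 := hle 0
    have h2 := (mem_supp_joinInr (m := ⦋n⦌) _).1
      (supp_comp_subset t' (joinInr.app ⦋n⦌) (apply_mem_supp _ 0))
    exact absurd h1 h2.not_ge
  | ofMap σ hσ h t' =>
    rename_i m
    obtain ⟨v, rfl⟩ := exists_comp_eq (joinInl_injective m) t' fun x hx ↦ by
      obtain ⟨a, rfl⟩ := mem_supp.1 hx
      refine (mem_supp_joinInl (m := m) _).2 ?_
      have h1 := hle a
      have h2 := joinOp_map_spec σ (t'.toOrderHom a)
      have h3 := (σ.toOrderHom (joinFold (n := m.len) (t'.toOrderHom a))).is_lt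
      change ((joinOp.map σ).toOrderHom (t'.toOrderHom a) : ℕ) ≤ n at h1
      dsimp only [SimplexCategory.len_mk] at h2 h3
      omega
    have e : v ≫ σ = t := comp_left_injective (joinInl_injective ⦋n⦌) <| by
      rw [ht]
      exact (Category.assoc v σ _).trans ((congrArg (v ≫ ·) (joinInl.naturality σ)).trans
        (Category.assoc v _ _).symm)
    rw [← map_QEval, H.eval_joinInl, ← Functor.map_comp_apply, ← op_comp, e]

/-- On simplices of `(Δ^n)ᵒᵖ`, the prescribed values agree. -/
lemma Rel.eq_right {l : SimplexCategory} {s : l ⟶ ⦋2 * n + 1⦌} {y} (h : H.Rel s y)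
    (t : l ⟶ SimplexCategory.rev.obj ⦋n⦌) (ht : t ≫ joinInr.app ⦋n⦌ = s) :
    y = C.toSSet.map t.op H.right := by
  have hlt (a : Fin (l.len + 1)) : n < (s.toOrderHom a : ℕ) := by
    rw [← ht]
    exact (mem_supp_joinInr (m := ⦋n⦌) _).1
      (supp_comp_subset t (joinInr.app ⦋n⦌) (apply_mem_supp _ a))
  cases h with
  | ofLeft t' =>
    have h1 := hlt 0
    have h2 := (mem_supp_joinInl (m := ⦋n⦌) _).1
      (supp_comp_subset t' (joinInl.app ⦋n⦌) (apply_mem_supp _ 0))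
    exact absurd h1 h2.not_gt
  | ofRight t' => rw [comp_left_injective (joinInr_injective _) ht]
  | ofMap σ hσ h t' =>
    rename_i m
    obtain ⟨v, rfl⟩ := exists_comp_eq (joinInr_injective m) t' fun x hx ↦ by
      obtain ⟨a, rfl⟩ := mem_supp.1 hx
      refine (mem_supp_joinInr (m := m) _).2 ?_
      have h1 := hlt a
      have h2 := joinOp_map_spec σ (t'.toOrderHom a)
      have h3 := (σ.toOrderHom (joinFold (n := m.len) (t'.toOrderHom a))).is_lt
      change n < ((joinOp.map σ).toOrderHom (t'.toOrderHom a) : ℕ) at h1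
      dsimp only [SimplexCategory.len_mk] at h2 h3
      omega
    have e : v ≫ SimplexCategory.rev.map σ = t :=
      comp_left_injective (joinInr_injective ⦋n⦌) <| by
        rw [ht]
        exact (Category.assoc v _ _).trans ((congrArg (v ≫ ·) (joinInr.naturality σ)).trans
          (Category.assoc v _ _).symm)
    rw [← map_QEval, H.eval_joinInr, ← Functor.map_comp_apply, ← op_comp, e]

/-- If a simplex lies in `Δ^σ ⋆ (Δ^σ)ᵒᵖ` and in `Δ^τ ⋆ (Δ^τ)ᵒᵖ`, then the two prescribed values
agree, as can be seen on the intersection of `σ` and `τ`. -/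
lemma QEval_map_eq {l m k : SimplexCategory} {σ : m ⟶ ⦋n⦌} {τ : k ⟶ ⦋n⦌}
    (hσ : Function.Injective σ.toOrderHom) (hτ : Function.Injective τ.toOrderHom)
    (hσ' : ∃ j, j ≠ i ∧ j ∉ supp σ) (hτ' : ∃ j, j ≠ i ∧ j ∉ supp τ)
    (s : l ⟶ joinOp.obj m) (t : l ⟶ joinOp.obj k) (h : s ≫ joinOp.map σ = t ≫ joinOp.map τ) :
    QEval (H.map σ hσ') s = QEval (H.map τ hτ') t := by
  have hmemσ (x) (hx : x ∈ supp (s ≫ joinOp.map σ)) : joinFold (n := n) x ∈ supp σ :=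
    (mem_supp_joinOp_map σ x).1 (supp_comp_subset _ _ hx)
  have hmemτ (x) (hx : x ∈ supp (s ≫ joinOp.map σ)) : joinFold (n := n) x ∈ supp τ := by
    rw [h] at hx
    exact (mem_supp_joinOp_map τ x).1 (supp_comp_subset _ _ hx)
  have hne : (supp σ ∩ supp τ).Nonempty :=
    ⟨_, Finset.mem_inter.2 ⟨hmemσ _ (apply_mem_supp _ 0), hmemτ _ (apply_mem_supp _ 0)⟩⟩
  obtain ⟨r, hr⟩ : ∃ r, (supp σ ∩ supp τ).card = r + 1 :=
    ⟨_, (Nat.succ_pred_eq_of_pos hne.card_pos).symm⟩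
  obtain ⟨φ, hφ, hφs⟩ := exists_supp_eq (l := ⦋n⦌) (supp σ ∩ supp τ) hr
  obtain ⟨a, ha⟩ := exists_comp_eq hσ φ (hφs.trans_subset Finset.inter_subset_left)
  obtain ⟨b, hb⟩ := exists_comp_eq hτ φ (hφs.trans_subset Finset.inter_subset_right)
  obtain ⟨u, hu⟩ := exists_comp_eq (joinOp_map_injective hφ) (s ≫ joinOp.map σ) fun x hx ↦ by
    refine (mem_supp_joinOp_map φ x).2 ?_
    rw [hφs]
    exact Finset.mem_inter.2 ⟨hmemσ x hx, hmemτ x hx⟩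
  have hs : u ≫ joinOp.map a = s := comp_left_injective (joinOp_map_injective hσ) <| by
    rw [Category.assoc, ← joinOp.map_comp, ha, hu]
  have ht : u ≫ joinOp.map b = t := comp_left_injective (joinOp_map_injective hτ) <| by
    rw [Category.assoc, ← joinOp.map_comp, hb, hu, h]
  obtain ⟨j, hj, hj'⟩ := hσ'
  have hφ' : ∃ j, j ≠ i ∧ j ∉ supp φ := ⟨j, hj, fun h ↦ hj' (supp_comp_subset a σ (ha ▸ h))⟩
  subst ha
  rw [← hs, ← ht, ← QEval_map, ← QEval_map, ← H.map_comp a σ _ hφ', ← H.map_comp b τ _ (hb ▸ hφ')]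
  congr 2
  exact hb.symm

lemma Rel.eq_map {l m : SimplexCategory} {s : l ⟶ ⦋2 * n + 1⦌} {y} (h : H.Rel s y)
    (σ : m ⟶ ⦋n⦌) (hσ : Function.Injective σ.toOrderHom) (hσ' : ∃ j, j ≠ i ∧ j ∉ supp σ)
    (t : l ⟶ joinOp.obj m) (ht : t ≫ joinOp.map σ = s) : y = QEval (H.map σ hσ') t := by
  have h' := Rel.ofMap (H := H) σ hσ hσ' t
  cases h with
  | ofLeft t' => exact (Rel.eq_left H h' t' ht.symm).symm
  | ofRight t' => exact (Rel.eq_right H h' t' ht.symm).symm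
  | ofMap τ hτ hτ' t' => exact H.QEval_map_eq hτ hσ hτ' hσ' t' t ht.symm

lemma Rel.unique {l : SimplexCategory} {s : l ⟶ ⦋2 * n + 1⦌} {y y'} (h : H.Rel s y)
    (h' : H.Rel s y') : y = y' := by
  cases h' with
  | ofLeft t => exact h.eq_left H t rfl
  | ofRight t => exact h.eq_right H t rfl
  | ofMap σ hσ hσ' t => exact h.eq_map H σ hσ hσ' t rfl

lemma exists_rel (hn : 0 < n) {l : SimplexCategory} (s : l ⟶ ⦋2 * n + 1⦌)
    (hs : IsHornSimplex n i (supp s)) : ∃ y, H.Rel s y := by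
  obtain hs | hs | ⟨j, hj, hji, hs⟩ := hs
  · obtain ⟨t, rfl⟩ := exists_comp_eq (joinInl_injective ⦋n⦌) s fun x hx ↦
      (mem_supp_joinInl (m := ⦋n⦌) x).2 (hs x hx)
    exact ⟨_, Rel.ofLeft t⟩
  · obtain ⟨t, rfl⟩ := exists_comp_eq (joinInr_injective ⦋n⦌) s fun x hx ↦
      (mem_supp_joinInr (m := ⦋n⦌) x).2 (hs x hx)
    exact ⟨_, Rel.ofRight t⟩
  · obtain ⟨m, rfl⟩ : ∃ m, n = m + 1 := ⟨n - 1, by omega⟩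
    let j' : Fin (m + 1 + 1) := ⟨j, by omega⟩
    have hsupp (x) : x ∈ supp (SimplexCategory.δ j') ↔ x ≠ j' := by
      rw [← Fin.exists_succAbove_eq_iff]
      exact mem_supp
    have hinj : Function.Injective (SimplexCategory.δ j').toOrderHom :=
      Fin.succAbove_right_injective
    obtain ⟨t, rfl⟩ := exists_comp_eq (joinOp_map_injective hinj) s fun x hx ↦ by
        refine (mem_supp_joinOp_map (SimplexCategory.δ j') x).2 ((hsupp _).2 fun h ↦ ?_)
        have h1 := hs x hx
        have h2 := joinFold_spec (n := m + 1) x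
        have h3 := congrArg Fin.val h
        dsimp only [j'] at h3
        have h4 : (x : ℕ) < 2 * (m + 1) + 1 + 1 := x.is_lt
        omega
    exact ⟨_, Rel.ofMap (SimplexCategory.δ j') hinj
      ⟨j', fun h ↦ hji (congrArg Fin.val h), fun h ↦ (hsupp _).1 h rfl⟩ t⟩

/-- The map from the corresponding horn of `Q(n)` which is adjoint to a lifting problem. -/
noncomputable def partialSimplex (hn : 0 < n) :
    PartialSimplex C.toSSet (2 * n + 1) (IsHornSimplex n i) :=
  .ofRel (fun _ s y ↦ H.Rel s y) (fun _ s hs ↦ H.exists_rel hn s hs)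
    (fun _ _ _ _ h h' ↦ h.unique H h') (fun _ _ g _ _ h ↦ h.comp H g)

lemma rel_partialSimplex (hn : 0 < n) {l : SimplexCategory} (s : l ⟶ ⦋2 * n + 1⦌)
    (hs : IsHornSimplex n i (supp s)) : H.Rel s ((H.partialSimplex hn).val s hs) :=
  PartialSimplex.rel_val (P := IsHornSimplex n i) s hs

/-- Injective maps reflect the thin triangles of `Q`. -/
lemma mem_QThin_of_twScaling {m : SimplexCategory} {σ : m ⟶ ⦋n⦌}
    (hσ : Function.Injective σ.toOrderHom) (t : ⦋2⦌ ⟶ joinOp.obj m)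
    (h01 : ((t ≫ joinOp.map σ).toOrderHom 0 : ℕ) < (t ≫ joinOp.map σ).toOrderHom 1)
    (h12 : ((t ≫ joinOp.map σ).toOrderHom 1 : ℕ) < (t ≫ joinOp.map σ).toOrderHom 2)
    (hT : twScaling n 0 ((t ≫ joinOp.map σ).toOrderHom 0) ((t ≫ joinOp.map σ).toOrderHom 1)
      ((t ≫ joinOp.map σ).toOrderHom 2)) :
    (SSet.stdSimplex.objEquiv.symm t : (Δ[2 * m.len + 1] : SSet.{u}) _⦋2⦌) ∈ QThin m.len := by
  have hmono : StrictMono σ.toOrderHom := σ.toOrderHom.monotone.strictMono_of_injective hσ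
  have hle (a b : Fin (2 * m.len + 1 + 1)) :
      (σ.toOrderHom (joinFold a) : ℕ) ≤ σ.toOrderHom (joinFold b) ↔
        (joinFold a : ℕ) ≤ joinFold b :=
    hmono.le_iff_le (a := joinFold a) (b := joinFold b)
  have e0 := joinOp_map_spec σ (t.toOrderHom 0)
  have e1 := joinOp_map_spec σ (t.toOrderHom 1)
  have e2 := joinOp_map_spec σ (t.toOrderHom 2)
  have l01 := hle (t.toOrderHom 0) (t.toOrderHom 1)
  have l10 := hle (t.toOrderHom 1) (t.toOrderHom 0)
  have l12 := hle (t.toOrderHom 1) (t.toOrderHom 2)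
  have l21 := hle (t.toOrderHom 2) (t.toOrderHom 1)
  have l20 := hle (t.toOrderHom 2) (t.toOrderHom 0)
  have l02 := hle (t.toOrderHom 0) (t.toOrderHom 2)
  have b0 : (joinFold (n := m.len) (t.toOrderHom 0) : ℕ) < m.len + 1 := Fin.is_lt _
  have b1 : (joinFold (n := m.len) (t.toOrderHom 1) : ℕ) < m.len + 1 := Fin.is_lt _
  have b2 : (joinFold (n := m.len) (t.toOrderHom 2) : ℕ) < m.len + 1 := Fin.is_lt _
  have c0 : (σ.toOrderHom (joinFold (n := m.len) (t.toOrderHom 0)) : ℕ) < n + 1 := Fin.is_lt _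
  have c1 : (σ.toOrderHom (joinFold (n := m.len) (t.toOrderHom 1)) : ℕ) < n + 1 := Fin.is_lt _
  have c2 : (σ.toOrderHom (joinFold (n := m.len) (t.toOrderHom 2)) : ℕ) < n + 1 := Fin.is_lt _
  change ((joinOp.map σ).toOrderHom (t.toOrderHom 0) : ℕ) <
    (joinOp.map σ).toOrderHom (t.toOrderHom 1) at h01
  change ((joinOp.map σ).toOrderHom (t.toOrderHom 1) : ℕ) <
    (joinOp.map σ).toOrderHom (t.toOrderHom 2) at h12
  change twScaling n 0 ((joinOp.map σ).toOrderHom (t.toOrderHom 0))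
    ((joinOp.map σ).toOrderHom (t.toOrderHom 1))
    ((joinOp.map σ).toOrderHom (t.toOrderHom 2)) at hT
  unfold twScaling at hT
  dsimp only [SimplexCategory.len_mk] at e0 e1 e2
  obtain e0 | e0 := e0 <;> obtain e1 | e1 := e1 <;> obtain e2 | e2 := e2
  · refine Or.inl (Or.inl fun a ↦ ?_)
    fin_cases a
    exacts [e0.1, e1.1, e2.1]
  · refine Or.inr ⟨_, _, _, ?_, ?_, ?_, Or.inl ⟨e0.2.1, e1.2.1, e2.2.1⟩⟩ <;> omega
  · omega
  · refine Or.inr ⟨_, _, _, ?_, ?_, ?_, Or.inr ⟨e0.2.1, e1.2.1, e2.2.1⟩⟩ <;> omega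
  · omega
  · omega
  · omega
  · refine Or.inl (Or.inr fun a ↦ ?_)
    fin_cases a
    exacts [e0.1, e1.1, e2.1]

/-- The lifting problem respects the scaling of `Q(n)`. -/
lemma respectsScaling_zero (hn : 0 < n) :
    (H.partialSimplex hn).RespectsScaling (twScaling n 0) := by
  rintro a b c hab hbc hT s hs rfl rfl rfl
  have h := H.rel_partialSimplex hn s hs
  generalize (H.partialSimplex hn).val s hs = y at h
  cases h with
  | ofLeft t => exact H.left_mem t
  | ofRight t => exact H.right_mem t
  | ofMap σ hσ hσ' t =>
    exact ScaledSSet.Hom.map_thin (H.map σ hσ') _ (Or.inr (mem_QThin_of_twScaling hσ t hab hbc hT))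

end TwHorn

/-! ### Solving lifting problems -/

/-- For `i = n`, the additional triangles in the scaling are thin as soon as this holds for the
triangles `Δ^{n-1,n,n-1̅}` and `Δ^{n-1,n̅,n-1̅}`: each of the others is a face of a `3`-simplex whose
remaining faces are already known to be thin. -/
lemma PartialSimplex.respectsScaling_last {C : ScaledSSet.{u}} [ScaledSSet.IsInftyBicategory C]
    {n : ℕ} (hn : 0 < n) {M : PartialSimplex C.toSSet (2 * n + 1) (IsHornSimplex n n)}
    (hM : M.RespectsScaling (twScaling n 0)) (h₁ : M.IsThinAt (n - 1) n (n + 2))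
    (h₂ : M.IsThinAt (n - 1) (n + 1) (n + 2)) : M.RespectsScaling (twScaling n n) := by
  intro a b c hab hbc hT s hs ha hb hc
  by_cases h0 : twScaling n 0 a b c
  · exact hM hab hbc h0 s hs ha hb hc
  have hP ⦃S S' : Finset (Fin (2 * n + 1 + 1))⦄ (h : S ⊆ S') (h' : IsHornSimplex n n S') :
      IsHornSimplex n n S := h'.mono h
  have hcn : c < 2 * n + 1 + 1 := by rw [← hc]; exact Fin.is_lt _
  unfold twScaling at hT h0
  obtain hs' | hs' | ⟨j, hjn, hj, hs'⟩ := id hs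
  · have := hs' _ (apply_mem_supp s 2)
    omega
  · have := hs' _ (apply_mem_supp s 0)
    omega
  have ja := hs' _ (apply_mem_supp s 0)
  have jb := hs' _ (apply_mem_supp s 1)
  have jc := hs' _ (apply_mem_supp s 2)
  rw [ha] at ja
  rw [hb] at jb
  rw [hc] at jc
  -- an additional triangle of the horn misses some `j` and `j̅` with `j < n - 1`, and so do the
  -- `3`-simplices obtained from it by adding a vertex over `n - 1` or `n`
  have hmem {x₀ x₁ x₂ x₃ : Fin (2 * n + 1 + 1)} (h : ∀ x ∈ ({x₀, x₁, x₂, x₃} : Finset _),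
      (x : ℕ) ≠ j ∧ (x : ℕ) ≠ 2 * n + 1 - j) : IsHornSimplex n n {x₀, x₁, x₂, x₃} :=
    Or.inr (Or.inr ⟨j, hjn, hj, h⟩)
  simp only [Finset.mem_insert, Finset.mem_singleton, forall_eq_or_imp, forall_eq] at hmem
  have hzero {x y z : ℕ} (hxy : x < y) (hyz : y < z) (h : twScaling n 0 x y z) :
      M.IsThinAt x y z := hM hxy hyz h
  unfold twScaling at hzero
  obtain rfl | hbn := eq_or_ne b n
  · obtain rfl | hap := eq_or_ne a (b - 1)
    · obtain rfl | hcp := eq_or_ne c (b + 2)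
      · exact h₁ s hs ha hb hc
      · exact isThinAt_zero_one_three hP (x₀ := ⟨b - 1, by omega⟩) (x₁ := ⟨b, by omega⟩)
          (x₂ := ⟨b + 2, by omega⟩) (x₃ := ⟨c, hcn⟩) hab (Fin.lt_def.2 (by dsimp only; omega))
          (Fin.lt_def.2 (by dsimp only; omega)) (hmem (by dsimp only; omega)) h₁
          (hzero (by dsimp only; omega) (by dsimp only; omega) (by dsimp only; omega))
          (hzero (by dsimp only; omega) (by dsimp only; omega) (by dsimp only; omega))
          s hs ha hb hc
    · obtain rfl : c = b + 2 := by omega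
      exact isThinAt_zero_two_three hP (x₀ := ⟨a, by omega⟩) (x₁ := ⟨b - 1, by omega⟩)
        (x₂ := ⟨b, by omega⟩) (x₃ := ⟨b + 2, hcn⟩) (Fin.lt_def.2 (by dsimp only; omega))
        (Fin.lt_def.2 (by dsimp only; omega)) hbc (hmem (by dsimp only; omega))
        (hzero (by dsimp only; omega) (by dsimp only; omega) (by dsimp only; omega))
        (hzero (by dsimp only; omega) (by dsimp only; omega) (by dsimp only; omega))
        h₁ s hs ha hb hc
  · obtain rfl : b = n + 1 := by omega
    obtain rfl | hap := eq_or_ne a (n - 1)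
    · obtain rfl | hcp := eq_or_ne c (n + 2)
      · exact h₂ s hs ha hb hc
      · exact isThinAt_zero_one_three hP (x₀ := ⟨n - 1, by omega⟩) (x₁ := ⟨n + 1, by omega⟩)
          (x₂ := ⟨n + 2, by omega⟩) (x₃ := ⟨c, hcn⟩) hab (Fin.lt_def.2 (by dsimp only; omega))
          (Fin.lt_def.2 (by dsimp only; omega)) (hmem (by dsimp only; omega)) h₂
          (hzero (by dsimp only; omega) (by dsimp only; omega) (by dsimp only; omega))
          (hzero (by dsimp only; omega) (by dsimp only; omega) (by dsimp only; omega))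
          s hs ha hb hc
    · obtain rfl : c = n + 2 := by omega
      exact isThinAt_zero_two_three hP (x₀ := ⟨a, by omega⟩) (x₁ := ⟨n - 1, by omega⟩)
        (x₂ := ⟨n + 1, by omega⟩) (x₃ := ⟨n + 2, hcn⟩) (Fin.lt_def.2 (by dsimp only; omega))
        (Fin.lt_def.2 (by dsimp only; omega)) hbc (hmem (by dsimp only; omega))
        (hzero (by dsimp only; omega) (by dsimp only; omega) (by dsimp only; omega))
        (hzero (by dsimp only; omega) (by dsimp only; omega) (by dsimp only; omega))
        h₂ s hs ha hb hc

lemma QHom_ext {C : ScaledSSet.{u}} {m : SimplexCategory} {x y : Q.obj m ⟶ C}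
    (h : QEval x (𝟙 (joinOp.obj m)) = QEval y (𝟙 (joinOp.obj m))) : x = y :=
  ScaledSSet.hom_ext (SSet.yonedaEquiv.injective h)

/-- The map `Q(n) ⟶ C` given by a totally defined simplex which respects the scaling. -/
lemma PartialSimplex.exists_QHom {C : ScaledSSet.{u}} {n i : ℕ}
    (M : PartialSimplex C.toSSet (2 * n + 1) fun _ ↦ True)
    (hM : M.RespectsScaling (twScaling n i)) :
    ∃ h : Q.obj ⦋n⦌ ⟶ C,
      (∀ {l : SimplexCategory} (s : l ⟶ ⦋2 * n + 1⦌), QEval h s = M.val s trivial) ∧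
      ((∀ a b c : ℕ, a < b → b < c → c ≤ 2 * n + 1 → twScaling n i a b c) →
        ∃ g : ScaledSSet.sharp (Δ[2 * n + 1] : SSet.{u}) ⟶ C,
          ScaledSSet.toSharp (Q.obj ⦋n⦌) ≫ g = h) := by
  let y := M.val (𝟙 ⦋2 * n + 1⦌) trivial
  have hy {l : SimplexCategory} (s : l ⟶ ⦋2 * n + 1⦌) : C.toSSet.map s.op y = M.val s trivial :=
    (M.map_val s (𝟙 _) trivial trivial).trans (M.val_congr (Category.comp_id s) _)
  have hdeg (x : (Δ[2 * n + 1] : SSet.{u}) _⦋2⦌) (hx : ¬ StrictMono x) :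
      (SSet.yonedaEquiv.symm y).app (op ⦋2⦌) x ∈ C.thin :=
    C.degenerate_subset_thin (SSet.degenerate_app_apply (by
      by_contra h
      exact hx ((SSet.stdSimplex.mem_nonDegenerate_iff_strictMono x).1 h)) _)
  have hthin (x : (Δ[2 * n + 1] : SSet.{u}) _⦋2⦌)
      (hx : (x 0 : ℕ) < x 1 → (x 1 : ℕ) < x 2 → twScaling n i (x 0) (x 1) (x 2)) :
      (SSet.yonedaEquiv.symm y).app (op ⦋2⦌) x ∈ C.thin := by
    by_cases hmono : StrictMono x
    · have h01 : x 0 < x 1 := hmono (by decide)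
      have h12 : x 1 < x 2 := hmono (by decide)
      have := hM h01 h12 (hx h01 h12) (SSet.stdSimplex.objEquiv x) trivial rfl rfl rfl
      rwa [← hy] at this
    · exact hdeg x hmono
  refine ⟨ScaledSSet.Hom.mk (SSet.yonedaEquiv.symm y)
    fun (x : (Δ[2 * n + 1] : SSet.{u}) _⦋2⦌) hx ↦ ?_, fun s ↦ hy s, fun h ↦ ?_⟩
  · obtain hx | hx := hx
    · exact C.degenerate_subset_thin (SSet.degenerate_app_apply hx _)
    · refine hthin x fun h01 h12 ↦ ?_
      have h2 := (x 2).is_lt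
      unfold twScaling
      obtain (hx | hx) | ⟨a, b, c, hab, hbc, hcn, ⟨e0, e1, e2⟩ | ⟨e0, e1, e2⟩⟩ := hx
      · exact Or.inl (hx 2)
      · exact Or.inr (Or.inl (hx 0))
      · dsimp only [SimplexCategory.len_mk] at *
        omega
      · dsimp only [SimplexCategory.len_mk] at *
        omega
  · exact ⟨ScaledSSet.Hom.mk (SSet.yonedaEquiv.symm y)
      fun (x : (Δ[2 * n + 1] : SSet.{u}) _⦋2⦌) _ ↦
        hthin x fun h01 h12 ↦ h _ _ _ h01 h12 (Nat.le_of_lt_succ (x 2).is_lt), rfl⟩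

namespace TwHorn

variable {C : ScaledSSet.{u}} {n : ℕ} {i : Fin (n + 1)} (H : TwHorn C n i)

/-- A solution of the lifting problem. -/
structure IsSolution (h : Q.obj ⦋n⦌ ⟶ C) : Prop where
  map_comp : ∀ {m : SimplexCategory} (σ : m ⟶ ⦋n⦌), Function.Injective σ.toOrderHom →
    ∀ hσ, Q.map σ ≫ h = H.map σ hσ
  eval_joinInl : QEval h (joinInl.app ⦋n⦌) = H.left
  eval_joinInr : QEval h (joinInr.app ⦋n⦌) = H.right

/-- A lifting problem which respects the scaling has a solution. For `n = 1` the scaling consists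
of all triangles, so that the solution is a marked edge. -/
lemma exists_isSolution [ScaledSSet.IsInftyBicategory C] (hi : 0 < i) (hn : 0 < n)
    (hH : (H.partialSimplex hn).RespectsScaling (twScaling n i)) :
    ∃ h, H.IsSolution h ∧
      ((∀ a b c : ℕ, a < b → b < c → c ≤ 2 * n + 1 → twScaling n i a b c) →
        ∃ g : ScaledSSet.sharp (Δ[2 * n + 1] : SSet.{u}) ⟶ C,
          ScaledSSet.toSharp (Q.obj ⦋n⦌) ≫ g = h) := by
  obtain ⟨M, hM, hMT⟩ :=
    (H.partialSimplex hn).exists_extends_of_isHornSimplex hi (Fin.is_le i) hH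
  obtain ⟨h, hh, hh'⟩ := M.exists_QHom hMT
  have key {l : SimplexCategory} {s : l ⟶ ⦋2 * n + 1⦌} (hs : IsHornSimplex n i (supp s)) :
      H.Rel s (QEval h s) := by
    rw [hh, hM s hs]
    exact H.rel_partialSimplex hn s hs
  refine ⟨h, ⟨fun {m} σ hσ hσ' ↦ QHom_ext ?_, ?_, ?_⟩, hh'⟩
  · rw [QEval_map]
    have hs : IsHornSimplex n i (supp (𝟙 (joinOp.obj m) ≫ joinOp.map σ)) := by
      obtain ⟨j, hji, hj⟩ := hσ'
      refine Or.inr (Or.inr ⟨j, Fin.is_le j, fun h ↦ hji (Fin.ext h), fun x hx ↦ ?_⟩)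
      have h1 := (mem_supp_joinOp_map σ x).1 (supp_comp_subset _ _ hx)
      have h2 := joinFold_spec (n := n) x
      have h3 : (joinFold (n := n) x : ℕ) ≠ j := fun h ↦ hj (Fin.ext h ▸ h1)
      have h4 := j.is_lt
      omega
    exact (key hs).eq_map H σ hσ hσ' _ rfl
  · have hs : IsHornSimplex n i (supp (joinInl.app ⦋n⦌)) :=
      Or.inl fun x hx ↦ (mem_supp_joinInl (m := ⦋n⦌) x).1 hx
    refine ((key hs).eq_left H (𝟙 _) (Category.id_comp _)).trans ?_
    exact Functor.map_id_apply C.toSSet (op ⦋n⦌) H.left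
  · have hs : IsHornSimplex n i (supp (joinInr.app ⦋n⦌)) :=
      Or.inr (Or.inl fun x hx ↦ (mem_supp_joinInr (m := ⦋n⦌) x).1 hx)
    refine ((key hs).eq_right H (𝟙 _) (Category.id_comp _)).trans ?_
    exact Functor.map_id_apply C.toSSet (op ⦋n⦌) H.right

/-- For inner horns, there are no additional triangles in the scaling. -/
lemma respectsScaling_of_lt (hn : 0 < n) (hi : i < Fin.last n) :
    (H.partialSimplex hn).RespectsScaling (twScaling n i) := by
  intro a b c hab hbc hT
  refine H.respectsScaling_zero hn hab hbc ?_
  rw [Fin.lt_def, Fin.val_last] at hi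
  unfold twScaling at *
  omega

/-- All triangles over a marked edge of the horn are thin. -/
lemma val_mem_thin_of_marked (hn : 0 < n) {σ : ⦋1⦌ ⟶ ⦋n⦌} (hσ : Function.Injective σ.toOrderHom)
    (hσ' : ∃ j, j ≠ i ∧ j ∉ supp σ) (hmarked : H.map σ hσ' ∈ (Tw C).marked)
    (s : ⦋2⦌ ⟶ ⦋2 * n + 1⦌) (hs : IsHornSimplex n i (supp s))
    (hfold : ∀ x ∈ supp s, joinFold (n := n) x ∈ supp σ) :
    (H.partialSimplex hn).val s hs ∈ C.thin := by
  obtain ⟨t, rfl⟩ := exists_comp_eq (joinOp_map_injective hσ) s fun x hx ↦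
    (mem_supp_joinOp_map σ x).2 (hfold x hx)
  rw [(H.rel_partialSimplex hn _ hs).eq_map H σ hσ hσ' t rfl]
  obtain ⟨g, hg⟩ := hmarked
  rw [← hg]
  exact ScaledSSet.Hom.map_thin g _ (Set.mem_univ _)

end TwHorn

/-! ### The canonical map is a Cartesian fibration -/

namespace TwHorn

variable {C : ScaledSSet.{u}} {n : ℕ} {i : Fin (n + 1)}

/-- The lifting problem given by a commutative square. -/
def ofSquare (f : (Λ[n, i] : SSet.{u}) ⟶ (Tw C).toSSet)
    (g : Δ[n] ⟶ (C.underlying : SSet.{u}) ⊗ (C.underlying : SSet.{u}).op)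
    (h : f ≫ twProj C = Λ[n, i].ι ≫ g) : TwHorn C n i where
  map {m} σ hσ := f.app (op m)
    ⟨SSet.stdSimplex.objEquiv.symm σ, (SSet.objEquiv_symm_mem_horn_iff σ).2 hσ⟩
  map_comp {k m} e σ hσ hσ' := f.naturality_apply e.op
    (⟨SSet.stdSimplex.objEquiv.symm σ, (SSet.objEquiv_symm_mem_horn_iff σ).2 hσ⟩ :
      (Λ[n, i] : SSet.{u}).obj (op m))
  left := (g.app (op ⦋n⦌) (SSet.stdSimplex.objEquiv.symm (𝟙 ⦋n⦌))).1.1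
  left_mem := (g.app (op ⦋n⦌) (SSet.stdSimplex.objEquiv.symm (𝟙 ⦋n⦌))).1.2
  right := (SSet.opObjEquiv (g.app (op ⦋n⦌) (SSet.stdSimplex.objEquiv.symm (𝟙 ⦋n⦌))).2).1
  right_mem := (SSet.opObjEquiv (g.app (op ⦋n⦌) (SSet.stdSimplex.objEquiv.symm (𝟙 ⦋n⦌))).2).2
  eval_joinInl {m} σ hσ := by
    have h1 := congrArg (fun q ↦ (q.app (op m)
      (⟨SSet.stdSimplex.objEquiv.symm σ, (SSet.objEquiv_symm_mem_horn_iff σ).2 hσ⟩ :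
        (Λ[n, i] : SSet.{u}).obj (op m))).1.1) h
    exact h1.trans (congrArg (fun q ↦ q.1.1) (SSet.app_objEquiv_symm g σ))
  eval_joinInr {m} σ hσ := by
    let φ (q : ((C.underlying : SSet.{u}) ⊗ (C.underlying : SSet.{u}).op).obj (op m)) :
        C.toSSet.obj (op m) :=
      (SSet.opObjEquiv (X := (C.underlying : SSet.{u})) q.2).1
    have h1 := congrArg (fun q ↦ φ (q.app (op m)
      (⟨SSet.stdSimplex.objEquiv.symm σ, (SSet.objEquiv_symm_mem_horn_iff σ).2 hσ⟩ :
        (Λ[n, i] : SSet.{u}).obj (op m)))) h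
    exact h1.trans (congrArg φ (SSet.app_objEquiv_symm g σ))

lemma IsSolution.comp_eq {n : ℕ} {i : Fin (n + 2)} {f : (Λ[n + 1, i] : SSet.{u}) ⟶ (Tw C).toSSet}
    {g : Δ[n + 1] ⟶ (C.underlying : SSet.{u}) ⊗ (C.underlying : SSet.{u}).op}
    {h : f ≫ twProj C = Λ[n + 1, i].ι ≫ g} {x : (Tw C).toSSet _⦋n + 1⦌}
    (hx : (ofSquare f g h).IsSolution x) :
    Λ[n + 1, i].ι ≫ SSet.yonedaEquiv.symm x = f ∧
      SSet.yonedaEquiv.symm x ≫ twProj C = g := by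
  constructor
  · refine SSet.horn.hom_ext _ _ fun j hj ↦ ?_
    exact hx.map_comp (SimplexCategory.δ j) Fin.succAbove_right_injective
      ((SSet.objEquiv_symm_mem_horn_iff.{u} _).1 (SSet.horn.face i j hj).2)
  · apply SSet.yonedaEquiv.injective
    rw [SSet.yonedaEquiv_symm_comp, Equiv.apply_symm_apply]
    exact Prod.ext (Subtype.ext hx.eval_joinInl) (Subtype.ext hx.eval_joinInr)

end TwHorn

/-- The projection from the enhanced twisted arrow category is an inner fibration. -/
lemma innerFibration_twProj (C : ScaledSSet.{u}) [ScaledSSet.IsInftyBicategory C] :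
    SSet.InnerFibration (twProj C) := by
  refine ⟨fun _ _ _ ⟨i, h0, hn⟩ ↦ ⟨fun {f g} sq ↦ ?_⟩⟩
  obtain ⟨x, hx, -⟩ := (TwHorn.ofSquare f g sq.w).exists_isSolution h0 (Nat.succ_pos _)
    (TwHorn.respectsScaling_of_lt _ _ hn)
  exact ⟨⟨⟨_, hx.comp_eq.1, hx.comp_eq.2⟩⟩⟩

/-- The triangles `Δ^{n-1,n,n-1̅}` and `Δ^{n-1,n̅,n-1̅}` lie over the last edge of the horn
`Λ^n_n`, so that they are thin if this edge is marked. -/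
lemma isCartesianEdge_of_marked (C : ScaledSSet.{u}) [ScaledSSet.IsInftyBicategory C]
    {e : (Tw C).toSSet _⦋1⦌} (he : e ∈ (Tw C).marked) : SSet.IsCartesianEdge (twProj C) e := by
  intro k f g h hfe
  let H := TwHorn.ofSquare f g h
  have hk : 0 < k + 2 := Nat.succ_pos _
  let x := SSet.horn.edge.{u} (k + 2) (Fin.last (k + 2)) (Fin.last (k + 1)).castSucc
      (Fin.last (k + 2)) (Fin.le_last _)
      (by rw [Finset.insert_eq_of_mem (by simp)]; exact Finset.card_le_two.trans (by omega))
  let σ : ⦋1⦌ ⟶ ⦋k + 2⦌ := SSet.stdSimplex.objEquiv x.1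
  have hσ' : ∃ j, j ≠ Fin.last (k + 2) ∧ j ∉ supp σ :=
    (SSet.objEquiv_symm_mem_horn_iff.{u} σ).1 x.2
  have h0 : (σ.toOrderHom 0 : ℕ) = k + 1 := rfl
  have h1 : (σ.toOrderHom 1 : ℕ) = k + 2 := rfl
  have hσ : Function.Injective σ.toOrderHom := by
    intro a b hab
    have := congrArg Fin.val hab
    fin_cases a <;> fin_cases b
    · rfl
    · exact absurd (h0.symm.trans (this.trans h1)) (by omega)
    · exact absurd (h1.symm.trans (this.trans h0)) (by omega)
    · rfl
  have hmarked : H.map σ hσ' ∈ (Tw C).marked := by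
    rw [← hfe] at he
    exact he
  have hfold (s : ⦋2⦌ ⟶ ⦋2 * (k + 2) + 1⦌)
      (hs : ∀ a : Fin 3, k + 1 ≤ (s.toOrderHom a : ℕ) ∧ (s.toOrderHom a : ℕ) ≤ k + 4)
      (y) (hy : y ∈ supp s) : joinFold (n := k + 2) y ∈ supp σ := by
    obtain ⟨a, rfl⟩ := mem_supp.1 hy
    have h2 := joinFold_spec (n := k + 2) (s.toOrderHom a)
    have h3 := hs a
    have h4 : (joinFold (n := k + 2) (s.toOrderHom a) : ℕ) = k + 1 ∨
      (joinFold (n := k + 2) (s.toOrderHom a) : ℕ) = k + 2 := by omega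
    obtain h4 | h4 := h4
    · exact mem_supp.2 ⟨0, Fin.ext h4.symm⟩
    · exact mem_supp.2 ⟨1, Fin.ext h4.symm⟩
  have hthin (b : ℕ) (hb : b = k + 2 ∨ b = k + 3) :
      (H.partialSimplex hk).IsThinAt (k + 1) b (k + 4) := by
    intro s hs e0 e1 e2
    refine H.val_mem_thin_of_marked hk hσ hσ' hmarked s hs (hfold s fun a ↦ ?_)
    fin_cases a
    · exact ⟨e0.ge, by dsimp only [Fin.zero_eta]; omega⟩
    · exact ⟨by dsimp only [Fin.mk_one]; omega, by dsimp only [Fin.mk_one]; omega⟩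
    · exact ⟨by dsimp only [Fin.reduceFinMk]; omega, e2.le⟩
  obtain ⟨y, hy, -⟩ := H.exists_isSolution (Fin.last_pos) hk
    (PartialSimplex.respectsScaling_last hk (H.respectsScaling_zero hk) (hthin _ (Or.inl rfl))
      (hthin _ (Or.inr rfl)))
  exact ⟨_, hy.comp_eq.1, hy.comp_eq.2⟩

/-- Edges of `𝒞 × 𝒞ᵒᵖ` lift to marked edges with a given target: this is the lifting problem for the
horn `Λ^1_1`. -/
lemma exists_marked_lift (C : ScaledSSet.{u}) [ScaledSSet.IsInftyBicategory C]
    (x : (Tw C).toSSet _⦋0⦌)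
    (f : ((C.underlying : SSet.{u}) ⊗ (C.underlying : SSet.{u}).op) _⦋1⦌)
    (hf : ((C.underlying : SSet.{u}) ⊗ (C.underlying : SSet.{u}).op).δ 0 f =
      (twProj C).app (op ⦋0⦌) x) :
    ∃ e ∈ (Tw C).marked, (Tw C).toSSet.δ 0 e = x ∧ (twProj C).app (op ⦋1⦌) e = f := by
  let f' : (Λ[0 + 1, 1] : SSet.{u}) ⟶ (Tw C).toSSet :=
    Λ[0 + 1, 1].ι ≫ SSet.yonedaEquiv.symm ((Tw C).toSSet.σ 0 x)
  have h : f' ≫ twProj C = Λ[0 + 1, 1].ι ≫ SSet.yonedaEquiv.symm f := by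
    refine SSet.horn.hom_ext _ _ fun j hj ↦ ?_
    obtain rfl : j = 0 := Fin.ext (by
      have := j.is_lt
      have : (j : ℕ) ≠ 1 := fun h ↦ hj (Fin.ext h)
      rw [Fin.val_zero]
      omega)
    refine Eq.trans ?_ hf.symm
    exact congrArg ((twProj C).app (op ⦋0⦌))
      (SSet.δ_comp_σ_self_apply (S := (Tw C).toSSet) (0 : Fin 1) x)
  -- the vertices `0` and `0̅` do not lie in a common simplex of the horn
  have hhorn (s : ⦋2⦌ ⟶ ⦋2 * 1 + 1⦌) (hs : IsHornSimplex 1 1 (supp s))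
      (e0 : (s.toOrderHom 0 : ℕ) = 0) (e2 : (s.toOrderHom 2 : ℕ) = 3) : False := by
    obtain hs | hs | ⟨j, hj, hj1, hs⟩ := hs
    · have := hs _ (apply_mem_supp s 2)
      omega
    · have := hs _ (apply_mem_supp s 0)
      omega
    · have := hs _ (apply_mem_supp s 0)
      omega
  obtain ⟨e, he, hmarked⟩ := (TwHorn.ofSquare f' _ h).exists_isSolution Nat.one_pos Nat.one_pos
    (PartialSimplex.respectsScaling_last Nat.one_pos (TwHorn.respectsScaling_zero _ _)
      (fun s hs e0 e1 e2 ↦ (hhorn s hs e0 e2).elim) (fun s hs e0 e1 e2 ↦ (hhorn s hs e0 e2).elim))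
  refine ⟨e, hmarked ?_, ?_, ?_⟩
  · intro a b c hab hbc hc
    unfold twScaling
    rw [Fin.val_one]
    omega
  · have h1 := congrArg (fun q ↦ q.app (op ⦋0⦌) (SSet.horn.face 1 0 (by decide))) he.comp_eq.1
    refine Eq.trans h1 ?_
    exact SSet.δ_comp_σ_self_apply (S := (Tw C).toSSet) (0 : Fin 1) x
  · have h1 := congrArg SSet.yonedaEquiv he.comp_eq.2
    rw [Equiv.apply_symm_apply] at h1
    refine Eq.trans ?_ h1
    exact (congrArg SSet.yonedaEquiv (SSet.yonedaEquiv_symm_comp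
      (X := (Tw C).toSSet) (n := ⦋1⦌) e (twProj C))).trans (Equiv.apply_symm_apply _ _) |>.symm

theorem mainTheorem3 (C : ScaledSSet.{u}) [ScaledSSet.IsInftyBicategory C] :
    SSet.IsCartesianFibration (twProj C) ∧
      ∀ e ∈ (Tw C).marked, SSet.IsCartesianEdge (twProj C) e := by
  refine ⟨⟨innerFibration_twProj C, fun x f hf ↦ ?_⟩, fun e he ↦ isCartesianEdge_of_marked C he⟩
  obtain ⟨e, he, hex, hef⟩ := exists_marked_lift C x f hf
  exact ⟨e, isCartesianEdge_of_marked C he, hex, hef⟩
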